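/- Let $\mathbb F$ be a field of characteristic different from $2$. Let $R$ be an irreducible, reduced, finite (crystallographic) root system in a $\mathbb Q$-vector space $V$ with a fixed set $\Pi$ of simple roots, weight lattice $X=\{\lambda\in V:\langle\lambda,\alpha^\vee\rangle\in\mathbb Z\ \forall\alpha\in R\}$ and highest root $\tilde\alpha$. For an affine root $\gamma=(\alpha,n)$, $\alpha\in R$, $n\in\mathbb Z$, let $s_\gamma(v)=v-(\langle\alpha,v\rangle+n)\alpha^\vee$ on $V^*$; call $\gamma$ positive if $n>0$, or $n=0$ and $\alpha>0$. Let $\widehat{\mathcal W}$ be the affine Weyl group generated by all $s_\gamma$, and $\widehat{\mathcal S}=\{s_{(\alpha,0)}:\alpha\in\Pi\}\cup\{s_{(-\tilde\alpha,1)}\}$ the set of simple reflections, which defines the length and the Bruhat order $\le$ on $\widehat{\mathcal W}$. Put $U=(X\oplus\mathbb Z)\otimes_{\mathbb Z}\mathbb F$ and let $S=S(U)$ be its symmetric algebra, graded with $U$ in degree $2$; graded means $\mathbb Z$-graded and homomorphisms of graded modules have degree $0$. The affine moment graph $\widehat{\mathcal G}$ has vertex set $\widehat{\mathcal W}$ with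 the Bruhat order and an edge $x\to y$ with label $\gamma\otimes1\in U$ whenever $x<y$ and $y=s_\gamma x$ for a positive affine root $\gamma$. For $s\in\widehat{\mathcal S}$, the quotient graph $\widehat{\mathcal G}^s$ has as vertices the cosets $\bar x=\{x,xs\}$, ordered by: $\bar x\le\bar y$ iff $u\le v$ for some $u\in\bar x$, $v\in\bar y$; for $\bar x\ne\bar y$, there is an edge $\bar x\to\bar y$ whenever there is an edge $u\to v$ in $\widehat{\mathcal G}$ with $u\in\bar x$, $v\in\bar y$, and it carries the same label. For an edge $E:x\to y$ of $\widehat{\mathcal G}$ with $\bar x\neq\bar y$, let $Es:xs\to ys$ be the shifted edge and $\bar E:\bar x\to\bar y$ the corresponding edge of $\widehat{\mathcal G}^s$. A moment graph has the GKM-property if the labels of any two different edges with a common vertex are not proportional; $\widehat{\mathcal G}_{\mathcal I}$ denotes the full subgraph on a set $\mathcal I$ of vertices. A sheaf $\mathcal M$ on a moment graph consists of a graded $S$-module $\mathcal M^x$ for each vertex $x$, a graded $S$-module $\mathcal M^E$ killed by the label of $E$ for each edge $E$, and a homomorphism $\rho_{x,E}:\mathcal M^x\to\mathcal M^E$ whenever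 $x$ lies on $E$. Put $\operatorname{supp}\mathcal M=\{x:\mathcal M^x\ne0\}$, and let $\Gamma(\mathcal I,\mathcal M)\subset\prod_{x\in\mathcal I}\mathcal M^x$ be the set of families $m$ with $\rho_{x,E}(m_x)=\rho_{y,E}(m_y)$ for all edges $E$ joining vertices $x,y\in\mathcal I$. The sheaf $\mathcal M$ is projective if: its support is finite; each $\mathcal M^x$ is graded free of finite rank; for each edge $E:x\to y$ with label $\alpha$ the map $\rho_{y,E}$ is surjective with kernel $\alpha\mathcal M^y$; every element of every $\mathcal M^x$ extends to a global section; and sections over an open (i.e. upward closed) set extend to every larger open set. For a projective sheaf $\mathcal P$ on $\widehat{\mathcal G}$, the sheaf $\mathcal N=\vartheta^s_{on}\mathcal P$ on $\widehat{\mathcal G}^s$ has stalks $\mathcal N^{\bar x}=\Gamma(\{x,xs\},\mathcal P)$; for an edge $\bar E:\bar x\to\bar y$ coming from $E:x\to y$, $\mathcal N^{\bar E}$ is the image of $\mathcal N^{\bar y}$ under $\rho_{y,E}\oplus\rho_{ys,Es}$ in $\mathcal P^E\oplus\mathcal P^{Es}$, and $\rho_{\bar y,\bar E}$, $\rho_{\bar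 x,\bar E}$ are the restrictions of $\rho_{y,E}\oplus\rho_{ys,Es}$ and $\rho_{x,E}\oplus\rho_{xs,Es}$. This is well defined if the latter maps $\mathcal N^{\bar x}$ into $\mathcal N^{\bar E}$ for every edge $\bar E$. For a sheaf $\mathcal N$ on $\widehat{\mathcal G}^s$, the sheaf $\mathcal M=\vartheta^s_{out}\mathcal N$ on $\widehat{\mathcal G}$ has $\mathcal M^x=\mathcal N^{\bar x}$; an edge $E$ between $x$ and $xs$ with label $a$ gets $\mathcal N^{\bar x}/a\mathcal N^{\bar x}$ with the natural projections, and every other edge $E$ gets $\mathcal N^{\bar E}$ with the restriction maps of $\mathcal N$. Put $\vartheta^s=\vartheta^s_{out}\circ\vartheta^s_{on}$. Theorem. Let $s\in\widehat{\mathcal S}$ and let $\mathcal P$ be a projective sheaf on $\widehat{\mathcal G}$ such that $\widehat{\mathcal G}_{\operatorname{supp}\mathcal P\cup(\operatorname{supp}\mathcal P)s}$ has the GKM-property. Then $\vartheta^s\mathcal P$ is well defined, that is, $\vartheta^s_{on}\mathcal P$ is well defined and is a projective sheaf on $\widehat{\mathcal G}^s$; moreover, $\vartheta^s\mathcal P$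 is a projective sheaf on $\widehat{\mathcal G}$, and its support is contained in $\operatorname{supp}\mathcal P\cup(\operatorname{supp}\mathcal P)s$. -/

import Mathlib

open scoped TensorProduct

universe u v e f w

namespace MomentGraphs

/-! ### Graded modules over the symmetric algebra -/

section Graded

/-- The degree `i` part of `S(U)`, for the grading in which the elements of `U` have degree `2`. -/
noncomputable def symDeg (𝔽 : Type f) (U : Type v) [Field 𝔽] [AddCommGroup U] [Module 𝔽 U]
    (i : ℤ) : Submodule 𝔽 (SymmetricAlgebra 𝔽 U) :=
  open Classical in
  if 0 ≤ i ∧ Even i then (LinearMap.range (SymmetricAlgebra.ι 𝔽 U)) ^ (i / 2).toNat else ⊥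

theorem ι_mem_symDeg {𝔽 : Type f} {U : Type v} [Field 𝔽] [AddCommGroup U] [Module 𝔽 U] (x : U) :
    SymmetricAlgebra.ι 𝔽 U x ∈ symDeg 𝔽 U 2 := by
  have h : (0 : ℤ) ≤ 2 ∧ Even (2 : ℤ) := by decide
  simp [symDeg]

/-- A `ℤ`-graded module over the graded algebra `S(U)`. -/
structure GradedMod (𝔽 : Type f) (U : Type v) [Field 𝔽] [AddCommGroup U] [Module 𝔽 U] where
  carrier : Type w
  [addCommGroup : AddCommGroup carrier]
  [module : Module (SymmetricAlgebra 𝔽 U) carrier]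
  deg : ℤ → AddSubgroup carrier
  isInternal : DirectSum.IsInternal deg
  smul_mem : ∀ {i j : ℤ} {a : SymmetricAlgebra 𝔽 U} {m : carrier},
    a ∈ symDeg 𝔽 U i → m ∈ deg j → a • m ∈ deg (i + j)

attribute [instance] GradedMod.addCommGroup GradedMod.module

instance (𝔽 : Type f) (U : Type v) [Field 𝔽] [AddCommGroup U] [Module 𝔽 U] :
    CoeSort (GradedMod.{v, f, w} 𝔽 U) (Type w) := ⟨GradedMod.carrier⟩

/-- Homomorphisms of graded modules: `S`-linear maps that are homogeneous of degree zero. -/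
structure GradedHom {𝔽 : Type f} {U : Type v} [Field 𝔽] [AddCommGroup U] [Module 𝔽 U]
    (A : GradedMod.{v, f, w} 𝔽 U) (B : GradedMod.{v, f, e} 𝔽 U) where
  toLin : A →ₗ[SymmetricAlgebra 𝔽 U] B
  map_deg : ∀ (i : ℤ) (m : A), m ∈ A.deg i → toLin m ∈ B.deg i

theorem isInternal_of_proj {M : Type w} [AddCommGroup M] (D : ℤ → AddSubgroup M)
    (p : ℤ → M →+ M) (h1 : ∀ i m, p i m ∈ D i) (h2 : ∀ i, ∀ m ∈ D i, p i m = m)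
    (h3 : ∀ i j, i ≠ j → ∀ m ∈ D j, p i m = 0)
    (h4 : ∀ m, ∃ t : Finset ℤ, m = ∑ i ∈ t, p i m) : DirectSum.IsInternal D := by
  classical
  have key : ∀ (x : DirectSum ℤ fun i => D i) (i : ℤ),
      p i (DirectSum.coeAddMonoidHom D x) = x i := by
    intro x i
    induction x using DirectSum.induction_on with
    | zero => simp
    | of j y =>
      rw [DirectSum.coeAddMonoidHom_of]
      by_cases hij : i = j
      · subst hij
        rw [h2 i y y.2, DirectSum.of_eq_same]
      · rw [h3 i j hij y y.2, DirectSum.of_eq_of_ne _ _ _ hij]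
        rfl
    | add x y hx hy => rw [map_add, map_add, hx, hy]; rfl
  constructor
  · rw [injective_iff_map_eq_zero]
    intro x hx
    ext i
    rw [← key x i, hx, map_zero]
    rfl
  · intro m
    obtain ⟨t, ht⟩ := h4 m
    refine ⟨∑ i ∈ t, DirectSum.of (fun i => D i) i ⟨p i m, h1 i m⟩, ?_⟩
    rw [map_sum]
    simp only [DirectSum.coeAddMonoidHom_of]
    exact ht.symm

section Proj

variable {𝔽 : Type f} {U : Type v} [Field 𝔽] [AddCommGroup U] [Module 𝔽 U]

/-- The projection of a graded module onto its degree `i` part. -/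
noncomputable def GradedMod.proj (M : GradedMod.{v, f, w} 𝔽 U) (i : ℤ) : M →+ M :=
  letI := M.isInternal.chooseDecomposition
  { toFun := fun m => (DirectSum.decompose M.deg m i : M)
    map_zero' := by simp
    map_add' := by intro x y; simp }

theorem GradedMod.proj_mem (M : GradedMod.{v, f, w} 𝔽 U) (i : ℤ) (m : M) :
    M.proj i m ∈ M.deg i := by
  let _ := M.isInternal.chooseDecomposition
  exact (DirectSum.decompose M.deg m i).2

theorem GradedMod.proj_same (M : GradedMod.{v, f, w} 𝔽 U) {i : ℤ} {m : M} (h : m ∈ M.deg i) :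
    M.proj i m = m := by
  let _ := M.isInternal.chooseDecomposition
  exact DirectSum.decompose_of_mem_same M.deg h

theorem GradedMod.proj_ne (M : GradedMod.{v, f, w} 𝔽 U) {i j : ℤ} (hij : i ≠ j) {m : M}
    (h : m ∈ M.deg j) : M.proj i m = 0 := by
  let _ := M.isInternal.chooseDecomposition
  exact DirectSum.decompose_of_mem_ne M.deg h hij.symm

theorem GradedMod.exists_sum (M : GradedMod.{v, f, w} 𝔽 U) (m : M) :
    ∃ t : Finset ℤ, (∀ i, i ∉ t → M.proj i m = 0) ∧ m = ∑ i ∈ t, M.proj i m := by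
  classical
  let _ := M.isInternal.chooseDecomposition
  refine ⟨(DirectSum.decompose M.deg m).support, ?_, ?_⟩
  · intro i hi
    have : DirectSum.decompose M.deg m i = 0 := by simpa using hi
    change (DirectSum.decompose M.deg m i : M) = 0
    rw [this]; rfl
  · exact (DirectSum.sum_support_decompose M.deg m).symm

theorem GradedMod.proj_map (M : GradedMod.{v, f, w} 𝔽 U) (N : GradedMod.{v, f, e} 𝔽 U)
    (g : M →+ N) (d : ℤ) (hg : ∀ i m, m ∈ M.deg i → g m ∈ N.deg (d + i)) (i : ℤ) (m : M) :
    N.proj (d + i) (g m) = g (M.proj i m) := by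
  obtain ⟨t, ht, hm⟩ := M.exists_sum m
  have h1 : N.proj (d + i) (g m) = ∑ j ∈ t, N.proj (d + i) (g (M.proj j m)) := by
    conv_lhs => rw [hm]
    simp
  rw [h1]
  by_cases hi : i ∈ t
  · rw [Finset.sum_eq_single_of_mem i hi]
    · exact N.proj_same (hg _ _ (M.proj_mem i m))
    · intro j _ hj
      exact N.proj_ne (by omega) (hg _ _ (M.proj_mem j m))
  · rw [ht i hi, map_zero]
    refine Finset.sum_eq_zero fun j hj => N.proj_ne ?_ (hg _ _ (M.proj_mem j m))
    rintro h
    have : i = j := by omega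
    exact hi (this ▸ hj)

theorem GradedHom.proj_apply {A : GradedMod.{v, f, w} 𝔽 U} {B : GradedMod.{v, f, e} 𝔽 U}
    (g : GradedHom A B) (i : ℤ) (m : A) : B.proj i (g.toLin m) = g.toLin (A.proj i m) := by
  have := GradedMod.proj_map A B g.toLin.toAddMonoidHom 0
    (by intro i m hm; rw [zero_add]; exact g.map_deg i m hm) i m
  rw [zero_add] at this
  exact this

/-- A homogeneous submodule of a graded module, with the induced grading. -/
noncomputable def GradedMod.sub (M : GradedMod.{v, f, w} 𝔽 U)
    (K : Submodule (SymmetricAlgebra 𝔽 U) M) (hK : ∀ m ∈ K, ∀ i, M.proj i m ∈ K) :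
    GradedMod.{v, f, w} 𝔽 U where
  carrier := K
  deg i := (M.deg i).comap K.subtype.toAddMonoidHom
  isInternal := by
    refine isInternal_of_proj _
      (fun i => ((M.proj i).comp K.subtype.toAddMonoidHom).codRestrict K.toAddSubgroup
        (fun m => hK m m.2 i)) ?_ ?_ ?_ ?_
    · exact fun i m => M.proj_mem i m
    · exact fun i m hm => Subtype.ext (M.proj_same hm)
    · exact fun i j hij m hm => Subtype.ext (M.proj_ne hij hm)
    · intro m
      obtain ⟨t, -, ht⟩ := M.exists_sum m
      refine ⟨t, Subtype.ext ?_⟩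
      rw [AddSubmonoidClass.coe_finsetSum]
      exact ht
  smul_mem := fun ha hm => M.smul_mem ha hm

/-- The quotient of a graded module by a homogeneous submodule, with the induced grading. -/
noncomputable def GradedMod.quot (M : GradedMod.{v, f, w} 𝔽 U)
    (K : Submodule (SymmetricAlgebra 𝔽 U) M) (hK : ∀ m ∈ K, ∀ i, M.proj i m ∈ K) :
    GradedMod.{v, f, w} 𝔽 U where
  carrier := M ⧸ K
  deg i := (M.deg i).map K.mkQ.toAddMonoidHom
  isInternal := by
    refine isInternal_of_proj _
      (fun i => QuotientAddGroup.map K.toAddSubgroup K.toAddSubgroup (M.proj i)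
        (fun m hm => hK m hm i)) ?_ ?_ ?_ ?_
    · intro i m
      obtain ⟨m, rfl⟩ := K.mkQ_surjective m
      exact ⟨M.proj i m, M.proj_mem i m, rfl⟩
    · rintro i _ ⟨m, hm, rfl⟩
      exact congrArg K.mkQ (M.proj_same hm)
    · rintro i j hij _ ⟨m, hm, rfl⟩
      exact (congrArg K.mkQ (M.proj_ne hij hm)).trans (map_zero _)
    · intro m
      obtain ⟨m, rfl⟩ := K.mkQ_surjective m
      obtain ⟨t, -, ht⟩ := M.exists_sum m
      exact ⟨t, (congrArg K.mkQ ht).trans (map_sum K.mkQ _ _)⟩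
  smul_mem := by
    rintro i j a _ ha ⟨m, hm, rfl⟩
    exact ⟨a • m, M.smul_mem ha hm, rfl⟩

/-- The direct sum of a finite family of graded modules. -/
noncomputable def GradedMod.pi {κ : Type e} [Finite κ] (M : κ → GradedMod.{v, f, w} 𝔽 U) :
    GradedMod.{v, f, max e w} 𝔽 U where
  carrier := ∀ k, M k
  deg i := AddSubgroup.pi Set.univ fun k => (M k).deg i
  isInternal := by
    classical
    have := Fintype.ofFinite κ
    refine isInternal_of_proj _
      (fun i => AddMonoidHom.mk' (fun m k => (M k).proj i (m k))
        (fun x y => funext fun k => map_add _ _ _)) ?_ ?_ ?_ ?_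
    · exact fun i m k _ => (M k).proj_mem i (m k)
    · exact fun i m hm => funext fun k => (M k).proj_same (hm k trivial)
    · exact fun i j hij m hm => funext fun k => (M k).proj_ne hij (hm k trivial)
    · intro m
      choose t ht0 ht using fun k => (M k).exists_sum (m k)
      refine ⟨Finset.univ.biUnion t, funext fun k => ?_⟩
      rw [Finset.sum_apply]
      refine (ht k).trans (Finset.sum_subset ?_ ?_)
      · exact Finset.subset_biUnion_of_mem t (Finset.mem_univ k)
      · exact fun i _ hi => ht0 k i hi
  smul_mem := fun ha hm k hk => (M k).smul_mem ha (hm k hk)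

theorem GradedMod.pi_proj {κ : Type e} [Finite κ] (M : κ → GradedMod.{v, f, w} 𝔽 U) (i : ℤ)
    (m : GradedMod.pi M) (k : κ) : (GradedMod.pi M).proj i m k = (M k).proj i (m k) := by
  have := GradedMod.proj_map (GradedMod.pi M) (M k)
    (Pi.evalAddMonoidHom (fun k => (M k : Type w)) k) 0
    (by intro i m hm; rw [zero_add]; exact hm k trivial) i m
  rw [zero_add] at this
  exact this.symm

/-- The module `M` is a free object in the category of finitely generated graded `S`-modules:
there is an isomorphism of graded modules `S⟨r₁⟩ ⊕ ⋯ ⊕ S⟨rₙ⟩ ≅ M`, where `S⟨r⟩ⱼ = Sⱼ₊ᵣ`. -/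
def GradedMod.IsFree (M : GradedMod.{v, f, w} 𝔽 U) : Prop :=
  ∃ (n : ℕ) (r : Fin n → ℤ) (φ : (Fin n → SymmetricAlgebra 𝔽 U) ≃ₗ[SymmetricAlgebra 𝔽 U] M),
    ∀ (j : ℤ) (a : Fin n → SymmetricAlgebra 𝔽 U),
      (∀ k, a k ∈ symDeg 𝔽 U (j + r k)) ↔ φ a ∈ M.deg j

end Proj

end Graded

/-! ### Moment graphs and sheaves on them -/

section Sheaves

set_option linter.checkUnivs false in
/-- A moment graph with labels in the vector space `U`. -/
structure MomentGraph (𝔽 : Type f) (U : Type v) [Field 𝔽] [AddCommGroup U] [Module 𝔽 U] where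
  Vertex : Type u
  [order : PartialOrder Vertex]
  Edge : Type e
  src : Edge → Vertex
  tgt : Edge → Vertex
  label : Edge → U
  label_ne_zero : ∀ E, label E ≠ 0
  src_lt_tgt : ∀ E, src E < tgt E

attribute [instance] MomentGraph.order

variable {𝔽 : Type f} {U : Type v} [Field 𝔽] [AddCommGroup U] [Module 𝔽 U]

/-- The full moment subgraph on a set `I` of vertices. -/
def MomentGraph.full (G : MomentGraph.{u, v, e, f} 𝔽 U) (I : Set G.Vertex) :
    MomentGraph.{u, v, e, f} 𝔽 U where
  Vertex := I
  Edge := {E : G.Edge // G.src E ∈ I ∧ G.tgt E ∈ I}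
  src E := ⟨G.src E.1, E.2.1⟩
  tgt E := ⟨G.tgt E.1, E.2.2⟩
  label E := G.label E.1
  label_ne_zero E := G.label_ne_zero E.1
  src_lt_tgt E := G.src_lt_tgt E.1

/-- The vertex `x` lies on the edge `E`. -/
def MomentGraph.LiesOn (G : MomentGraph.{u, v, e, f} 𝔽 U) (x : G.Vertex) (E : G.Edge) : Prop :=
  x = G.src E ∨ x = G.tgt E

/-- The GKM-property: labels of two different edges with a common vertex are not proportional. -/
def MomentGraph.GKM (G : MomentGraph.{u, v, e, f} 𝔽 U) : Prop :=
  ∀ (E E' : G.Edge) (x : G.Vertex), E ≠ E' → G.LiesOn x E → G.LiesOn x E' →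
    G.label E' ∉ Submodule.span 𝔽 {G.label E}

/-- The data that a sheaf attaches to an edge with label `a`: a graded module killed by `a`,
and the two restriction maps to it, from the stalk `A` at the start and from the stalk `B` at the
end of the edge. -/
structure EdgeDatum (A B : GradedMod.{v, f, w} 𝔽 U) (a : U) where
  mod : GradedMod.{v, f, w} 𝔽 U
  label_smul : ∀ m : mod, SymmetricAlgebra.ι 𝔽 U a • m = 0
  rhoSrc : GradedHom A mod
  rhoTgt : GradedHom B mod

/-- A sheaf on a moment graph. -/
structure Sheaf (G : MomentGraph.{u, v, e, f} 𝔽 U) where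
  stalk : G.Vertex → GradedMod.{v, f, w} 𝔽 U
  edge : ∀ E : G.Edge, EdgeDatum (stalk (G.src E)) (stalk (G.tgt E)) (G.label E)

namespace Sheaf

variable {G : MomentGraph.{u, v, e, f} 𝔽 U}

/-- The support of a sheaf: the vertices with nonzero stalk. -/
def supp (M : Sheaf.{u, v, e, f, w} G) : Set G.Vertex := {x | Nontrivial (M.stalk x)}

/-- The sections `Γ(I, M)` over a set of vertices. -/
def sections (M : Sheaf.{u, v, e, f, w} G) (I : Set G.Vertex) :
    Submodule (SymmetricAlgebra 𝔽 U) (∀ x : I, M.stalk x) where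
  carrier := {m | ∀ (E : G.Edge) (hx : G.src E ∈ I) (hy : G.tgt E ∈ I),
    (M.edge E).rhoSrc.toLin (m ⟨G.src E, hx⟩) = (M.edge E).rhoTgt.toLin (m ⟨G.tgt E, hy⟩)}
  zero_mem' := by intro E hx hy; simp
  add_mem' := by
    intro m m' hm hm' E hx hy
    simp [hm E hx hy, hm' E hx hy]
  smul_mem' := by
    intro a m hm E hx hy
    simp [hm E hx hy]

/-- The sections over a finite set of vertices, as a graded module. -/
noncomputable def gradedSections (M : Sheaf.{u, v, e, f, w} G) (I : Set G.Vertex) [Finite I] :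
    GradedMod.{v, f, max u w} 𝔽 U :=
  (GradedMod.pi fun x : I => M.stalk x).sub (M.sections I) (by
    intro m hm i E hx hy
    rw [GradedMod.pi_proj, GradedMod.pi_proj, ← GradedHom.proj_apply, ← GradedHom.proj_apply]
    exact congrArg _ (hm E hx hy))

/-- Every element of every stalk extends to a global section. -/
def GeneratedByGlobalSections (M : Sheaf.{u, v, e, f, w} G) : Prop :=
  ∀ (x : G.Vertex) (a : M.stalk x), ∃ m ∈ M.sections Set.univ, m ⟨x, trivial⟩ = a

/-- Sections over open sets extend to larger open sets; a set of vertices is open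
when it is an upper set. -/
def Flabby (M : Sheaf.{u, v, e, f, w} G) : Prop :=
  ∀ (I' I : Set G.Vertex) (hI : I' ⊆ I), IsUpperSet I' → IsUpperSet I →
    ∀ m' ∈ M.sections I', ∃ m ∈ M.sections I, ∀ x : I', m ⟨x, hI x.2⟩ = m' x

/-- Projective sheaves. -/
structure IsProjective (M : Sheaf.{u, v, e, f, w} G) : Prop where
  finite_supp : M.supp.Finite
  free : ∀ x, (M.stalk x).IsFree
  surjective : ∀ E, Function.Surjective (M.edge E).rhoTgt.toLin
  ker : ∀ (E : G.Edge) (m : M.stalk (G.tgt E)), (M.edge E).rhoTgt.toLin m = 0 ↔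
    ∃ m' : M.stalk (G.tgt E), m = SymmetricAlgebra.ι 𝔽 U (G.label E) • m'
  generated : M.GeneratedByGlobalSections
  flabby : M.Flabby

end Sheaf

/-- The graded module `A / a A`, for a vector `a`, with both restriction maps equal to the
natural projection. -/
noncomputable def EdgeDatum.modLabel (A : GradedMod.{v, f, w} 𝔽 U) (a : U) : EdgeDatum A A a :=
  let K : Submodule (SymmetricAlgebra 𝔽 U) A :=
    LinearMap.range (LinearMap.lsmul (SymmetricAlgebra 𝔽 U) A (SymmetricAlgebra.ι 𝔽 U a))
  have hK : ∀ m ∈ K, ∀ i, A.proj i m ∈ K := by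
    rintro _ ⟨m, rfl⟩ i
    refine ⟨A.proj (i - 2) m, ?_⟩
    have := GradedMod.proj_map A A (DistribSMul.toAddMonoidHom A (SymmetricAlgebra.ι 𝔽 U a)) 2
      (fun i m hm => A.smul_mem (ι_mem_symDeg a) hm) (i - 2) m
    rw [show 2 + (i - 2) = i by ring] at this
    exact this.symm
  { mod := A.quot K hK
    label_smul := by
      intro m
      obtain ⟨m, rfl⟩ := K.mkQ_surjective m
      exact (Submodule.Quotient.mk_eq_zero K).mpr ⟨m, rfl⟩
    rhoSrc := ⟨K.mkQ, fun _ m hm => ⟨m, hm, rfl⟩⟩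
    rhoTgt := ⟨K.mkQ, fun _ m hm => ⟨m, hm, rfl⟩⟩ }

end Sheaves

/-! ### Length and Bruhat order -/

section Bruhat

variable {W : Type u} [Group W]

/-- The length of `g` with respect to a generating set: the least length of a word with
letters in `S` and product `g`. -/
noncomputable def wordLength (S : Set W) (g : W) : ℕ∞ :=
  ⨅ (l : List W) (_ : (∀ x ∈ l, x ∈ S) ∧ l.prod = g), (l.length : ℕ∞)

/-- One step up in the Bruhat order: left multiplication by a reflection (a conjugate of an
element of `S`) that increases the length. -/
def BruhatStep (S : Set W) (x y : W) : Prop :=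
  (∃ g : W, ∃ s ∈ S, y = g * s * g⁻¹ * x) ∧ wordLength S x < wordLength S y

theorem eq_or_length_lt {S : Set W} {x y : W} (h : Relation.ReflTransGen (BruhatStep S) x y) :
    x = y ∨ wordLength S x < wordLength S y := by
  induction h with
  | refl => exact Or.inl rfl
  | tail _ h ih =>
    rcases ih with rfl | ih
    · exact Or.inr h.2
    · exact Or.inr (ih.trans h.2)

/-- The Bruhat order. -/
@[reducible] def bruhatOrder (S : Set W) : PartialOrder W where
  le := Relation.ReflTransGen (BruhatStep S)
  le_refl _ := Relation.ReflTransGen.refl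
  le_trans _ _ _ := Relation.ReflTransGen.trans
  le_antisymm x y h h' := by
    rcases eq_or_length_lt h with h | h
    · exact h
    · rcases eq_or_length_lt h' with h' | h'
      · exact h'.symm
      · exact absurd (h.trans h') (lt_irrefl _)

end Bruhat

/-! ### The affine Weyl group -/

section Affine

set_option linter.unusedSectionVars false

variable {ι N : Type u} {V : Type v} [AddCommGroup V] [Module ℚ V] [AddCommGroup N] [Module ℚ N]
variable (P : RootPairing ι ℚ V N)

/-- The value at `x` of the affine functional given by an affine root. The affine root `(α, n)`
is encoded by the pair of the index of the root `α` and the integer `n`; the vector space `N`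
is the dual of `V` through the pairing `P.toLinearMap`. -/
def affineEval (γ : ι × ℤ) (x : N) : ℚ := P.toLinearMap (P.root γ.1) x + γ.2

theorem affineEval_sub_smul (γ δ : ι × ℤ) (c : ℚ) (x : N) :
    affineEval P γ (x - c • P.coroot δ.1) = affineEval P γ x - c * P.pairing γ.1 δ.1 := by
  simp [affineEval]; ring

theorem affineEval_involutive (γ : ι × ℤ) :
    Function.Involutive fun x : N => x - affineEval P γ x • P.coroot γ.1 := by
  intro x
  simp only [affineEval_sub_smul, P.pairing_same, sub_smul, mul_smul]
  module

/-- The affine reflection `s_γ`, for the affine root `γ = (α, n)`: it sends `x` to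
`x - (⟨α, x⟩ + n) α^∨`, so it is the reflection `s_{α,-n}`. -/
def affineReflectionPerm (γ : ι × ℤ) : Equiv.Perm N :=
  (affineEval_involutive P γ).toPerm

/-- The affine Weyl group, generated by all affine reflections of `N = V^*`. -/
def affineWeylGroup : Subgroup (Equiv.Perm N) :=
  Subgroup.closure (Set.range (affineReflectionPerm P))

/-- The affine reflections as elements of the affine Weyl group. -/
def affineReflection (γ : ι × ℤ) : affineWeylGroup P :=
  ⟨affineReflectionPerm P γ, Subgroup.subset_closure ⟨γ, rfl⟩⟩

theorem affineReflection_mul_self (γ : ι × ℤ) :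
    affineReflection P γ * affineReflection P γ = 1 :=
  Subtype.ext (Equiv.ext fun x => affineEval_involutive P γ x)

theorem affineReflection_inv (γ : ι × ℤ) : (affineReflection P γ)⁻¹ = affineReflection P γ :=
  inv_eq_of_mul_eq_one_left (affineReflection_mul_self P γ)

/-- The negative of an affine root. -/
def negAffine (γ : ι × ℤ) : ι × ℤ := (P.reflectionPerm γ.1 γ.1, -γ.2)

theorem affineEval_neg (γ : ι × ℤ) (x : N) :
    affineEval P (negAffine P γ) x = -affineEval P γ x := by
  simp [affineEval, negAffine, P.root_reflectionPerm]; ring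

theorem affineReflection_neg (γ : ι × ℤ) :
    affineReflection P (negAffine P γ) = affineReflection P γ := by
  refine Subtype.ext (Equiv.ext fun x => ?_)
  change x - affineEval P (negAffine P γ) x • P.coroot (P.reflectionPerm γ.1 γ.1) = _
  rw [affineEval_neg, P.coroot_reflectionPerm, P.coreflection_apply_self, neg_smul_neg]
  rfl

theorem affineEval_injective {γ δ : ι × ℤ} (h : ∀ x, affineEval P γ x = affineEval P δ x) :
    γ = δ := by
  have h0 : γ.2 = δ.2 := by simpa [affineEval] using h 0
  refine Prod.ext (P.root.injective ?_) h0
  apply P.toPerfPair.injective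
  ext x
  simpa [affineEval, h0] using h x

variable [P.IsCrystallographic]

/-- The action of an affine reflection on the affine roots. -/
noncomputable def reflectAffine (δ γ : ι × ℤ) : ι × ℤ :=
  (P.reflectionPerm δ.1 γ.1, γ.2 - P.pairingIn ℤ γ.1 δ.1 * δ.2)

theorem affineEval_reflectAffine (δ γ : ι × ℤ) (x : N) :
    affineEval P (reflectAffine P δ γ) x = affineEval P γ (affineReflectionPerm P δ x) := by
  change _ = affineEval P γ (x - affineEval P δ x • P.coroot δ.1)
  rw [affineEval_sub_smul]
  have := P.algebraMap_pairingIn ℤ γ.1 δ.1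
  simp only [algebraMap_int_eq, eq_intCast] at this
  simp [affineEval, reflectAffine, P.root_reflectionPerm, P.reflection_apply, this]
  ring

theorem affineReflection_conj (δ γ : ι × ℤ) :
    affineReflection P δ * affineReflection P γ * (affineReflection P δ)⁻¹ =
      affineReflection P (reflectAffine P δ γ) := by
  rw [affineReflection_inv]
  refine Subtype.ext (Equiv.ext fun x => ?_)
  change affineReflectionPerm P δ (affineReflectionPerm P γ (affineReflectionPerm P δ x)) =
    x - affineEval P (reflectAffine P δ γ) x • P.coroot (P.reflectionPerm δ.1 γ.1)
  rw [affineEval_reflectAffine, P.coroot_reflectionPerm, P.coreflection_apply]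
  have hx : affineReflectionPerm P δ (affineReflectionPerm P δ x) = x :=
    affineEval_involutive P δ x
  generalize affineReflectionPerm P δ x = y at *
  subst hx
  change (y - affineEval P γ y • P.coroot γ.1) -
    affineEval P δ (y - affineEval P γ y • P.coroot γ.1) • P.coroot δ.1 =
    (y - affineEval P δ y • P.coroot δ.1) - _
  rw [affineEval_sub_smul]
  simp only [RootPairing.root_coroot_eq_pairing, RootPairing.root', sub_smul, smul_sub, mul_smul]
  module

/-- The affine Weyl group element `g` sends the affine root `γ` to the affine root `γ'`. -/
def SendsRoot (g : affineWeylGroup P) (γ γ' : ι × ℤ) : Prop :=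
  (∀ x, affineEval P γ' (g.1 x) = affineEval P γ x) ∧
    g * affineReflection P γ * g⁻¹ = affineReflection P γ'

variable {P} in
theorem SendsRoot.mul {g h : affineWeylGroup P} {γ γ' γ'' : ι × ℤ}
    (hg : SendsRoot P g γ' γ'') (hh : SendsRoot P h γ γ') : SendsRoot P (g * h) γ γ'' := by
  refine ⟨fun x => (hg.1 _).trans (hh.1 x), ?_⟩
  rw [← hg.2, ← hh.2]
  group

theorem sendsRoot_reflection (δ γ : ι × ℤ) :
    SendsRoot P (affineReflection P δ) γ (reflectAffine P δ γ) := by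
  refine ⟨fun x => ?_, affineReflection_conj P δ γ⟩
  rw [affineEval_reflectAffine]
  exact congrArg _ (affineEval_involutive P δ x)

theorem exists_sendsRoot (g : affineWeylGroup P) (γ : ι × ℤ) : ∃ γ', SendsRoot P g γ γ' := by
  suffices h : (∀ γ, ∃ γ', SendsRoot P g γ γ') ∧ ∀ γ, ∃ γ', SendsRoot P g⁻¹ γ γ' from h.1 γ
  clear γ
  obtain ⟨g, hg⟩ := g
  induction hg using Subgroup.closure_induction with
  | mem g hg =>
    obtain ⟨δ, rfl⟩ := hg
    refine ⟨fun γ => ⟨_, sendsRoot_reflection P δ γ⟩, fun γ => ⟨reflectAffine P δ γ, ?_⟩⟩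
    have := sendsRoot_reflection P δ γ
    rw [← affineReflection_inv] at this
    exact this
  | one =>
    have : ∀ γ, SendsRoot P 1 γ γ := fun γ => ⟨fun x => rfl, by group⟩
    exact ⟨fun γ => ⟨γ, this γ⟩, fun γ => ⟨γ, by
      rw [show (⟨1, _⟩ : affineWeylGroup P) = 1 from rfl, inv_one]; exact this γ⟩⟩
  | mul g h hg hh ihg ihh =>
    rw [show (⟨g * h, _⟩ : affineWeylGroup P) = ⟨g, hg⟩ * ⟨h, hh⟩ from rfl, mul_inv_rev]
    refine ⟨fun γ => ?_, fun γ => ?_⟩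
    · obtain ⟨γ1, h1⟩ := ihh.1 γ
      obtain ⟨γ2, h2⟩ := ihg.1 γ1
      exact ⟨γ2, h2.mul h1⟩
    · obtain ⟨γ1, h1⟩ := ihg.2 γ
      obtain ⟨γ2, h2⟩ := ihh.2 γ1
      exact ⟨γ2, h2.mul h1⟩
  | inv g hg ih =>
    rw [show (⟨g⁻¹, _⟩ : affineWeylGroup P) = (⟨g, hg⟩)⁻¹ from rfl, inv_inv]
    exact ih.symm

variable {P} in
theorem SendsRoot.unique {g : affineWeylGroup P} {γ δ ε : ι × ℤ}
    (h : SendsRoot P g γ δ) (h' : SendsRoot P g γ ε) : δ = ε := by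
  refine affineEval_injective P fun x => ?_
  obtain ⟨y, rfl⟩ := g.1.surjective x
  rw [h.1, h'.1]

theorem sendsRoot_neg {g : affineWeylGroup P} {γ δ : ι × ℤ} (h : SendsRoot P g γ δ) :
    SendsRoot P g (negAffine P γ) (negAffine P δ) := by
  refine ⟨fun x => ?_, ?_⟩
  · rw [affineEval_neg, affineEval_neg, h.1]
  · rw [affineReflection_neg, affineReflection_neg, h.2]

theorem reflectAffine_self (γ : ι × ℤ) : reflectAffine P γ γ = negAffine P γ := by
  refine Prod.ext rfl ?_
  simp [reflectAffine, negAffine]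
  ring

theorem reflectAffine_reflectAffine (δ γ : ι × ℤ) :
    reflectAffine P δ (reflectAffine P δ γ) = γ := by
  refine affineEval_injective P fun x => ?_
  rw [affineEval_reflectAffine, affineEval_reflectAffine]
  exact congrArg _ (affineEval_involutive P δ x)

/-! ### Positive affine roots and simple reflections -/

variable {P} (b : P.Base)

/-- The affine root `(α, n)` is positive if `n > 0`, or if `n = 0` and `α` is positive. -/
def IsPosAffine (γ : ι × ℤ) : Prop := 0 < γ.2 ∨ γ.2 = 0 ∧ b.IsPos γ.1

/-- The index `θ` belongs to the highest root: `θ - β` is a sum of simple roots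
for every root `β`. -/
def IsHighestRoot (θ : ι) : Prop :=
  ∀ i, P.root θ - P.root i ∈ AddSubmonoid.closure (P.root '' b.support)

/-- The simple affine roots: `(α, 0)` for simple `α`, and `(-θ, 1)` for the highest root `θ`. -/
def simpleAffineRoots : Set (ι × ℤ) :=
  {γ | γ.1 ∈ b.support ∧ γ.2 = 0} ∪
    {γ | ∃ θ, IsHighestRoot b θ ∧ P.root γ.1 = -P.root θ ∧ γ.2 = 1}

/-- The simple reflections of the affine Weyl group. -/
def simpleReflections : Set (affineWeylGroup P) := affineReflection P '' simpleAffineRoots b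

theorem isPosAffine_neg (γ : ι × ℤ) : IsPosAffine b (negAffine P γ) ↔ ¬ IsPosAffine b γ := by
  have h := RootPairing.Base.IsPos.neg_iff_not b γ.1
  change b.IsPos (P.reflectionPerm γ.1 γ.1) ↔ _ at h
  simp only [IsPosAffine, negAffine, h]
  by_cases hb : b.IsPos γ.1 <;> simp only [hb] <;> simp <;> omega

variable [Finite ι] [P.IsRootSystem] [P.IsReduced]

theorem exists_height_functional :
    ∃ h : V →ₗ[ℚ] ℚ, (∀ i, h (P.root i) = b.height i) ∧
      ∀ x ∈ AddSubmonoid.closure (P.root '' b.support), 0 ≤ h x ∧ (h x = 0 → x = 0) := by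
  refine ⟨b.toWeightBasis.constr ℚ fun _ => (1 : ℚ), ?_, ?_⟩
  · intro i
    obtain ⟨g, -, -, hg⟩ := b.exists_root_eq_sum_int i
    rw [b.height_eq_sum hg, hg, map_sum]
    push_cast
    refine Finset.sum_congr rfl fun j hj => ?_
    have : b.toWeightBasis.constr ℚ (fun _ => (1 : ℚ)) (P.root j) = 1 := by
      rw [← b.toWeightBasis_apply ⟨j, hj⟩, Module.Basis.constr_basis]
    rw [map_zsmul, this]
    simp
  · intro x hx
    induction hx using AddSubmonoid.closure_induction with
    | mem x hx =>
      obtain ⟨j, hj, rfl⟩ := hx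
      rw [← b.toWeightBasis_apply ⟨j, hj⟩, Module.Basis.constr_basis]
      norm_num
    | zero => simp
    | add x y _ _ hx hy =>
      rw [map_add]
      refine ⟨add_nonneg hx.1 hy.1, fun h => ?_⟩
      rw [hx.2 (by linarith [hx.1, hy.1]), hy.2 (by linarith [hx.1, hy.1]), add_zero]

theorem height_le_of_isHighest {θ : ι} (hθ : IsHighestRoot b θ) (i : ι) :
    b.height i ≤ b.height θ ∧ (b.height i = b.height θ → i = θ) := by
  obtain ⟨h, h1, h2⟩ := exists_height_functional b
  obtain ⟨h3, h4⟩ := h2 _ (hθ i)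
  rw [map_sub, h1, h1] at h3 h4
  refine ⟨by exact_mod_cast sub_nonneg.mp h3, fun h => P.root.injective ?_⟩
  exact (sub_eq_zero.mp (h4 (by rw [h, sub_self]))).symm

theorem isPos_of_isHighest {θ : ι} (hθ : IsHighestRoot b θ) : b.IsPos θ := by
  have h1 := (height_le_of_isHighest b hθ (P.reflectionPerm θ θ)).1
  have h2 := b.height_reflectionPerm_self θ
  change b.height (P.reflectionPerm θ θ) = _ at h2
  rw [RootPairing.Base.isPos_iff']
  omega

theorem pairing_highest {θ i : ι} (hθ : IsHighestRoot b θ) (hi : b.IsPos i) :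
    0 ≤ P.pairingIn ℤ i θ ∧ (i ≠ θ → P.pairingIn ℤ i θ ≤ 1) := by
  have hθpos := isPos_of_isHighest b hθ
  rw [RootPairing.Base.isPos_iff] at hi hθpos
  constructor
  · by_contra! hlt
    have hne : P.root i ≠ -P.root θ := by
      intro h
      have h' : P.root i = P.root (P.reflectionPerm θ θ) := by
        rw [h, P.root_reflectionPerm, P.reflection_apply_self]
      have h2 := b.height_reflectionPerm_self θ
      change b.height (P.reflectionPerm θ θ) = _ at h2
      rw [← P.root.injective h'] at h2
      omega
    obtain ⟨k, hk⟩ := P.root_add_root_mem_of_pairingIn_neg hlt hne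
    have := b.height_add hk
    have := (height_le_of_isHighest b hθ k).1
    omega
  · intro hne
    by_contra! hlt
    let k := P.reflectionPerm θ i
    have hk : P.root k = P.root i + (-P.pairingIn ℤ i θ) • P.root θ := by
      rw [P.root_reflectionPerm, P.reflection_apply_root' ℤ, neg_smul, sub_eq_add_neg]
    have h1 := b.height_add_zsmul hk
    have h2 := b.height_reflectionPerm_self k
    change b.height (P.reflectionPerm k k) = _ at h2
    have h3 := (height_le_of_isHighest b hθ (P.reflectionPerm k k)).1
    have h4 := height_le_of_isHighest b hθ i
    have h5 : b.height i ≠ b.height θ := fun h => hne (h4.2 h)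
    rw [h2, h1] at h3
    simp only [smul_eq_mul] at h3
    have h6 : b.height i < b.height θ := lt_of_le_of_ne h4.1 h5
    nlinarith

theorem isPosAffine_of_simple {γ : ι × ℤ} (hγ : γ ∈ simpleAffineRoots b) : IsPosAffine b γ := by
  rcases hγ with hγ | ⟨θ, -, -, h⟩
  · exact Or.inr ⟨hγ.2, RootPairing.Base.isPos_of_mem_support hγ.1⟩
  · exact Or.inl (by rw [h]; exact one_pos)

/-- A simple reflection permutes the positive affine roots different from its simple root. -/
theorem isPosAffine_reflectAffine {γ β : ι × ℤ} (hγ : γ ∈ simpleAffineRoots b)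
    (hβ : IsPosAffine b β) (hne : β ≠ γ) : IsPosAffine b (reflectAffine P γ β) := by
  obtain ⟨i, n⟩ := β
  obtain ⟨j, m⟩ := γ
  rcases hγ with ⟨hj, hm⟩ | ⟨θ, hθ, hj, hm⟩
  · dsimp only at hj hm
    subst hm
    rcases hβ with hn | ⟨hn, hi⟩
    · exact Or.inl (by simpa [reflectAffine] using hn)
    · dsimp only at hn hi
      subst hn
      refine Or.inr ⟨by simp [reflectAffine], hi.reflectionPerm hj ?_⟩
      rintro rfl
      exact hne rfl
  · dsimp only at hj hm
    subst hm
    have hj' : j = P.reflectionPerm θ θ :=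
      P.root.injective (by rw [hj, P.root_reflectionPerm, P.reflection_apply_self])
    have hp : P.pairingIn ℤ i j = -P.pairingIn ℤ i θ := by
      rw [hj', P.pairingIn_reflectionPerm_self_right]
    have hr : ∀ k, P.root (P.reflectionPerm j k) = P.root k + (-P.pairingIn ℤ k θ) • P.root θ := by
      intro k
      have hpk : P.pairingIn ℤ k j = -P.pairingIn ℤ k θ := by
        rw [hj', P.pairingIn_reflectionPerm_self_right]
      rw [P.root_reflectionPerm, P.reflection_apply_root' ℤ, hpk, hj]
      module
    have hheight := b.height_add_zsmul (hr i)
    have hθpos := isPos_of_isHighest b hθ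
    have h0 := b.height_ne_zero (P.reflectionPerm j i)
    simp only [IsPosAffine, reflectAffine, hp, RootPairing.Base.isPos_iff] at hβ hθpos ⊢
    by_cases hi : b.IsPos i
    · have h1 := (pairing_highest b hθ hi).1
      rw [RootPairing.Base.isPos_iff] at hi
      by_cases h2 : P.pairingIn ℤ i θ = 0
      · rw [h2] at hheight
        simp at hheight
        rw [hheight, h2]
        simpa using hβ
      · left
        omega
    · have hneg := (RootPairing.Base.IsPos.neg_iff_not b i).mpr hi
      change b.IsPos (P.reflectionPerm i i) at hneg
      have h1 := pairing_highest b hθ hneg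
      rw [P.pairingIn_reflectionPerm_self_left] at h1
      rw [RootPairing.Base.isPos_iff] at hi
      have hn : 0 < n := by
        rcases hβ with h | h
        · exact h
        · exact absurd h.2 hi
      by_cases hiθ : P.reflectionPerm i i = θ
      · have hij : i = j := by
          apply P.root.injective
          rw [hj, ← hiθ, P.root_reflectionPerm, P.reflection_apply_self, neg_neg]
        have hn1 : n ≠ 1 := by
          rintro rfl
          exact hne (by rw [hij])
        have h2 : P.pairingIn ℤ i θ = -2 := by
          have := P.pairingIn_same ℤ i
          rw [hij, hj', P.pairingIn_reflectionPerm_self_left, P.pairingIn_same]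
        have h3 : b.height i = - b.height θ := by
          have := b.height_reflectionPerm_self θ
          change b.height (P.reflectionPerm θ θ) = _ at this
          rw [hij, hj', this]
        rw [h2, h3] at hheight
        rw [h2]
        simp at hheight
        omega
      · have h2 := h1.2 hiθ
        have h3 := (height_le_of_isHighest b hθ (P.reflectionPerm i i)).1
        have h4 := b.height_reflectionPerm_self i
        change b.height (P.reflectionPerm i i) = _ at h4
        rcases (show P.pairingIn ℤ i θ = 0 ∨ P.pairingIn ℤ i θ = -1 by omega) with h5 | h5
        · left; omega
        · rw [h5] at hheight ⊢
          simp at hheight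
          omega

/-! ### Exchange and the Bruhat order modulo a simple reflection -/

theorem exists_wordLength_eq {W : Type u} [Group W] {S : Set W} {g : W}
    (h : wordLength S g ≠ ⊤) :
    ∃ l : List W, (∀ x ∈ l, x ∈ S) ∧ l.prod = g ∧ wordLength S g = l.length := by
  rw [wordLength, iInf_subtype'] at h
  rcases isEmpty_or_nonempty {l : List W // (∀ x ∈ l, x ∈ S) ∧ l.prod = g} with hE | hE
  · exact absurd (iInf_of_empty _) h
  · obtain ⟨⟨l, hl⟩, hl'⟩ := ENat.exists_eq_iInf
      (fun l : {l : List W // (∀ x ∈ l, x ∈ S) ∧ l.prod = g} => (l.1.length : ℕ∞))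
    exact ⟨l, hl.1, hl.2, by rw [wordLength, iInf_subtype']; exact hl'.symm⟩

theorem wordLength_le {W : Type u} [Group W] {S : Set W} {l : List W} (h : ∀ x ∈ l, x ∈ S) :
    wordLength S l.prod ≤ l.length :=
  iInf₂_le_of_le l ⟨h, rfl⟩ le_rfl

theorem wordLength_mul_ne_top {W : Type u} [Group W] {S : Set W} {g s : W} (hs : s ∈ S)
    (h : wordLength S g ≠ ⊤) : wordLength S (g * s) ≠ ⊤ := by
  obtain ⟨l, hl, rfl, -⟩ := exists_wordLength_eq h
  have : wordLength S (l ++ [s]).prod ≤ ((l ++ [s]).length : ℕ∞) := wordLength_le (by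
    intro x hx
    rcases List.mem_append.mp hx with hx | hx
    · exact hl x hx
    · rw [List.mem_singleton.mp hx]; exact hs)
  rw [List.prod_append, List.prod_singleton] at this
  exact ne_top_of_le_ne_top (ENat.natCast_ne_top _) this

theorem exchange (l : List (affineWeylGroup P)) (hl : ∀ x ∈ l, x ∈ simpleReflections b)
    {β β' : ι × ℤ} (hβ : IsPosAffine b β) (h : SendsRoot P l.prod β β')
    (hβ' : ¬ IsPosAffine b β') :
    ∃ l' : List (affineWeylGroup P), (∀ x ∈ l', x ∈ simpleReflections b) ∧
      l'.length < l.length ∧ l'.prod = l.prod * affineReflection P β := by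
  induction l generalizing β' with
  | nil =>
    have h1 : SendsRoot P 1 β β := ⟨fun x => rfl, by group⟩
    exact absurd (h.unique h1 ▸ hβ) hβ'
  | cons s l ih =>
    have hl' : ∀ x ∈ l, x ∈ simpleReflections b := fun x hx => hl x (List.mem_cons_of_mem s hx)
    obtain ⟨γ, hγ, rfl⟩ := hl s List.mem_cons_self
    obtain ⟨δ, hδ⟩ := exists_sendsRoot P l.prod β
    rw [List.prod_cons] at h
    have h2 : β' = reflectAffine P γ δ := h.unique ((sendsRoot_reflection P γ δ).mul hδ)
    by_cases hδpos : IsPosAffine b δ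
    · have hδγ : δ = γ := by
        by_contra hne
        exact hβ' (h2 ▸ isPosAffine_reflectAffine b hγ hδpos hne)
      subst hδγ
      refine ⟨l, hl', by simp, ?_⟩
      rw [List.prod_cons, ← hδ.2]
      have := affineReflection_mul_self P β
      calc l.prod = l.prod * (affineReflection P β * affineReflection P β) := by rw [this, mul_one]
        _ = _ := by group
    · obtain ⟨l', h3, h4, h5⟩ := ih hl' hδ hδpos
      refine ⟨affineReflection P γ :: l', ?_, by simpa using h4, by
        rw [List.prod_cons, List.prod_cons, h5, mul_assoc]⟩
      intro x hx
      rcases List.mem_cons.mp hx with rfl | hx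
      · exact ⟨γ, hγ, rfl⟩
      · exact h3 x hx

theorem wordLength_lt_of_neg {g : affineWeylGroup P} {β β' : ι × ℤ}
    (hg : wordLength (simpleReflections b) g ≠ ⊤) (hβ : IsPosAffine b β)
    (h : SendsRoot P g β β') (hβ' : ¬ IsPosAffine b β') :
    wordLength (simpleReflections b) (g * affineReflection P β) <
      wordLength (simpleReflections b) g := by
  obtain ⟨l, hl, rfl, hlen⟩ := exists_wordLength_eq hg
  obtain ⟨l', h1, h2, h3⟩ := exchange b l hl hβ h hβ'
  rw [← h3, hlen]
  exact (wordLength_le h1).trans_lt (by exact_mod_cast h2)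

theorem wordLength_lt_shift {γ β : ι × ℤ} (hγ : γ ∈ simpleAffineRoots b)
    (hβ : IsPosAffine b β) (hne : β ≠ γ) {u : affineWeylGroup P}
    (h : wordLength (simpleReflections b) u <
      wordLength (simpleReflections b) (u * affineReflection P β)) :
    wordLength (simpleReflections b) (u * affineReflection P γ) <
      wordLength (simpleReflections b) (u * affineReflection P β * affineReflection P γ) := by
  have hu : wordLength (simpleReflections b) u ≠ ⊤ := ne_top_of_lt h
  have hus := wordLength_mul_ne_top (S := simpleReflections b) ⟨γ, hγ, rfl⟩ hu
  obtain ⟨δ, hδ⟩ := exists_sendsRoot P u β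
  have hδpos : IsPosAffine b δ := by
    by_contra hn
    exact lt_asymm h (wordLength_lt_of_neg b hu hβ hδ hn)
  by_cases hv : wordLength (simpleReflections b)
      (u * affineReflection P β * affineReflection P γ) = ⊤
  · rw [hv]
    exact lt_top_iff_ne_top.mpr hus
  · have hγβ : SendsRoot P (affineReflection P γ) (reflectAffine P γ β) β := by
      have := sendsRoot_reflection P γ (reflectAffine P γ β)
      rwa [reflectAffine_reflectAffine] at this
    have hββ := sendsRoot_reflection P β β
    rw [reflectAffine_self] at hββ
    have h1 : SendsRoot P (u * affineReflection P β * affineReflection P γ)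
        (reflectAffine P γ β) (negAffine P δ) :=
      ((sendsRoot_neg P hδ).mul hββ).mul hγβ
    have h2 := wordLength_lt_of_neg b hv (isPosAffine_reflectAffine b hγ hβ hne) h1
      (fun h => (isPosAffine_neg b δ).mp h hδpos)
    have h3 : u * affineReflection P β * affineReflection P γ *
        affineReflection P (reflectAffine P γ β) = u * affineReflection P γ := by
      rw [← affineReflection_conj]
      have e1 := affineReflection_mul_self P γ
      have e2 := affineReflection_mul_self P β
      rw [affineReflection_inv]
      calc _ = u * affineReflection P β * (affineReflection P γ * affineReflection P γ) *
            affineReflection P β * affineReflection P γ := by group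
        _ = u * (affineReflection P β * affineReflection P β) * affineReflection P γ := by
            rw [e1]; group
        _ = _ := by rw [e2]; group
    rwa [h3] at h2

theorem wordLength_mul_simple_ne {s : affineWeylGroup P} (hs : s ∈ simpleReflections b)
    {u : affineWeylGroup P} (hu : wordLength (simpleReflections b) u ≠ ⊤) :
    wordLength (simpleReflections b) (u * s) ≠ wordLength (simpleReflections b) u := by
  obtain ⟨γ, hγ, rfl⟩ := hs
  have hpos := isPosAffine_of_simple b hγ
  obtain ⟨δ, hδ⟩ := exists_sendsRoot P u γ
  by_cases hδpos : IsPosAffine b δ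
  · have hus := wordLength_mul_ne_top (S := simpleReflections b) ⟨γ, hγ, rfl⟩ hu
    have h1 := sendsRoot_reflection P γ γ
    rw [reflectAffine_self] at h1
    have h2 := wordLength_lt_of_neg b hus hpos ((sendsRoot_neg P hδ).mul h1)
      (fun h => (isPosAffine_neg b δ).mp h hδpos)
    rw [mul_assoc, affineReflection_mul_self, mul_one] at h2
    exact h2.ne'
  · exact (wordLength_lt_of_neg b hu hpos hδ hδpos).ne

theorem bruhatStep_shift {s : affineWeylGroup P} (hs : s ∈ simpleReflections b)
    {x y : affineWeylGroup P} (h : BruhatStep (simpleReflections b) x y) :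
    y = x * s ∨ BruhatStep (simpleReflections b) (x * s) (y * s) := by
  obtain ⟨⟨g, t, ht, rfl⟩, hlt⟩ := h
  have hβ : ∃ β, IsPosAffine b β ∧ g * t * g⁻¹ * x = x * affineReflection P β := by
    obtain ⟨δ, -, rfl⟩ := ht
    obtain ⟨β, hβ⟩ := exists_sendsRoot P (x⁻¹ * g) δ
    have e : g * affineReflection P δ * g⁻¹ * x = x * affineReflection P β := by
      rw [← hβ.2]; group
    by_cases hp : IsPosAffine b β
    · exact ⟨β, hp, e⟩
    · exact ⟨negAffine P β, (isPosAffine_neg b β).mpr hp, by rw [affineReflection_neg, e]⟩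
  obtain ⟨β, hβ, e⟩ := hβ
  obtain ⟨γ, hγ, rfl⟩ := hs
  by_cases hne : β = γ
  · left; rw [e, hne]
  · right
    refine ⟨⟨g, t, ht, by group⟩, ?_⟩
    rw [e] at hlt ⊢
    exact wordLength_lt_shift b hγ hβ hne hlt

/-- The shorter of the two elements `x` and `x s`. -/
noncomputable def shorter (s x : affineWeylGroup P) : affineWeylGroup P :=
  open Classical in
  if wordLength (simpleReflections b) x ≤ wordLength (simpleReflections b) (x * s) then x else x * s

theorem bruhatStep_simple {s : affineWeylGroup P} (hs : s ∈ simpleReflections b)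
    {x : affineWeylGroup P} (h : wordLength (simpleReflections b) x <
      wordLength (simpleReflections b) (x * s)) :
    BruhatStep (simpleReflections b) x (x * s) :=
  ⟨⟨x, s, hs, by group⟩, h⟩

theorem mul_simple_self {s : affineWeylGroup P} (hs : s ∈ simpleReflections b) : s * s = 1 := by
  obtain ⟨γ, -, rfl⟩ := hs
  exact affineReflection_mul_self P γ

theorem shorter_mul {s : affineWeylGroup P} (hs : s ∈ simpleReflections b)
    {x : affineWeylGroup P} (h : wordLength (simpleReflections b) x ≠ ⊤) :
    shorter b s (x * s) = shorter b s x := by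
  have h1 := wordLength_mul_simple_ne b hs h
  have h2 : x * s * s = x := by rw [mul_assoc, mul_simple_self b hs, mul_one]
  rw [shorter, shorter, h2]
  rcases lt_or_gt_of_ne h1 with h3 | h3
  · rw [if_pos h3.le, if_neg (not_le.mpr h3)]
  · rw [if_neg (not_le.mpr h3), if_pos h3.le]

theorem shorter_mono {s : affineWeylGroup P} (hs : s ∈ simpleReflections b)
    {x y : affineWeylGroup P} (h : Relation.ReflTransGen (BruhatStep (simpleReflections b)) x y) :
    Relation.ReflTransGen (BruhatStep (simpleReflections b)) (shorter b s x) (shorter b s y) := by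
  induction h with
  | refl => exact Relation.ReflTransGen.refl
  | tail _ h ih =>
    rename_i y z _
    refine ih.trans ?_
    have hy : wordLength (simpleReflections b) y ≠ ⊤ := ne_top_of_lt h.2
    have hne := wordLength_mul_simple_ne b hs hy
    have hss : y * s * s = y := by rw [mul_assoc, mul_simple_self b hs, mul_one]
    rcases bruhatStep_shift b hs h with rfl | h'
    · rw [shorter_mul b hs hy]
    · have key : Relation.ReflTransGen (BruhatStep (simpleReflections b)) (shorter b s y) y ∧
          Relation.ReflTransGen (BruhatStep (simpleReflections b)) (shorter b s y) (y * s) := by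
        rw [shorter]
        split_ifs with hle
        · exact ⟨.refl, .single (bruhatStep_simple b hs (lt_of_le_of_ne hle hne.symm))⟩
        · have := bruhatStep_simple b hs (x := y * s) (by rw [hss]; exact not_le.mp hle)
          rw [hss] at this
          exact ⟨.single this, .refl⟩
      conv_rhs => rw [shorter]
      split_ifs
      · exact key.1.tail h
      · exact key.2.tail h'

theorem mk_eq_iff {s : affineWeylGroup P} (hs : s ∈ simpleReflections b)
    {x y : affineWeylGroup P} :
    (x : affineWeylGroup P ⧸ Subgroup.zpowers s) = y ↔ y = x ∨ y = x * s := by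
  rw [QuotientGroup.eq, Subgroup.mem_zpowers_iff]
  constructor
  · rintro ⟨k, hk⟩
    have hy : y = x * s ^ k := by rw [hk]; group
    have h2 : s ^ (2 : ℤ) = 1 := by rw [zpow_two]; exact mul_simple_self b hs
    rcases Int.even_or_odd' k with ⟨m, rfl | rfl⟩
    · left; rw [hy, zpow_mul, h2]; simp
    · right; rw [hy, zpow_add, zpow_mul, h2]; simp
  · rintro (rfl | rfl)
    · exact ⟨0, by simp⟩
    · exact ⟨1, by simp⟩

theorem shorter_mk (s x : affineWeylGroup P) :
    ((shorter b s x : affineWeylGroup P) : affineWeylGroup P ⧸ Subgroup.zpowers s) = x := by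
  rw [shorter]
  split_ifs
  · rfl
  · rw [QuotientGroup.eq]
    simp

theorem shorter_eq_of_mk_eq {s : affineWeylGroup P} (hs : s ∈ simpleReflections b)
    {x y : affineWeylGroup P} (hx : wordLength (simpleReflections b) x ≠ ⊤)
    (h : (x : affineWeylGroup P ⧸ Subgroup.zpowers s) = y) : shorter b s x = shorter b s y := by
  rcases (mk_eq_iff b hs).mp h with rfl | rfl
  · rfl
  · exact (shorter_mul b hs hx).symm

/-- The order on the left cosets of `{1, s}` induced by the Bruhat order: `x ≤ y` if there are
representatives `u` of `x` and `v` of `y` such that `u ≤ v`. -/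
@[reducible] def quotientOrder {s : affineWeylGroup P} (hs : s ∈ simpleReflections b) :
    PartialOrder (affineWeylGroup P ⧸ Subgroup.zpowers s) where
  le x y := ∃ u v : affineWeylGroup P, (u : affineWeylGroup P ⧸ Subgroup.zpowers s) = x ∧
    (v : affineWeylGroup P ⧸ Subgroup.zpowers s) = y ∧ (bruhatOrder (simpleReflections b)).le u v
  le_refl x := by
    obtain ⟨u, rfl⟩ := QuotientGroup.mk_surjective x
    exact ⟨u, u, rfl, rfl, Relation.ReflTransGen.refl⟩
  le_trans := by
    rintro x y z ⟨u, v, rfl, rfl, huv⟩ ⟨v', w, hv, rfl, hvw⟩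
    rcases eq_or_length_lt hvw with rfl | hlt
    · exact ⟨u, v, rfl, hv.symm, huv⟩
    · refine ⟨shorter b s u, shorter b s w, shorter_mk b s u, shorter_mk b s w, ?_⟩
      have h1 := shorter_mono b hs huv
      rw [← shorter_eq_of_mk_eq b hs (ne_top_of_lt hlt) hv] at h1
      exact h1.trans (shorter_mono b hs hvw)
  le_antisymm := by
    rintro x y ⟨u, v, rfl, rfl, huv⟩ ⟨v', u', hv, hu, hvu⟩
    rcases eq_or_length_lt huv with rfl | hlt
    · rfl
    rcases eq_or_length_lt hvu with rfl | hlt'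
    · exact hu.symm.trans hv
    have h1 := shorter_mono b hs huv
    have h2 := shorter_mono b hs hvu
    rw [shorter_eq_of_mk_eq b hs (ne_top_of_lt hlt') hv,
      ← shorter_eq_of_mk_eq b hs (ne_top_of_lt hlt) hu.symm] at h2
    have h3 := (bruhatOrder (simpleReflections b)).le_antisymm _ _ h1 h2
    rw [← shorter_mk b s u, h3, shorter_mk]

end Affine

/-! ### The affine moment graph and its quotient -/

section AffineGraph

variable {ι N : Type u} {V : Type v} [AddCommGroup V] [Module ℚ V] [AddCommGroup N] [Module ℚ N]
  {P : RootPairing ι ℚ V N} [P.IsCrystallographic] (b : P.Base)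

variable (P) in
/-- The weight lattice `X`. -/
def weightLattice : AddSubgroup V where
  carrier := {v | ∀ i, ∃ k : ℤ, P.toLinearMap v (P.coroot i) = k}
  zero_mem' i := ⟨0, by simp⟩
  add_mem' := by
    intro x y hx hy i
    obtain ⟨k, hk⟩ := hx i
    obtain ⟨l, hl⟩ := hy i
    exact ⟨k + l, by simp [hk, hl]⟩
  neg_mem' := by
    intro x hx i
    obtain ⟨k, hk⟩ := hx i
    exact ⟨-k, by simp [hk]⟩

theorem root_mem_weightLattice (i : ι) : P.root i ∈ weightLattice P :=
  fun j => ⟨P.pairingIn ℤ i j, by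
    rw [RootPairing.root_coroot_eq_pairing, ← P.algebraMap_pairingIn ℤ i j]; simp⟩

variable (P) in
/-- The vector space `(X ⊕ ℤ) ⊗ 𝔽` of labels. -/
abbrev LabelSpace (𝔽 : Type f) [Field 𝔽] : Type (max f v) := 𝔽 ⊗[ℤ] (weightLattice P × ℤ)

variable (P) in
/-- The label `γ ⊗ 1` of an affine root `γ`. -/
noncomputable def affineLabel (𝔽 : Type f) [Field 𝔽] (γ : ι × ℤ) : LabelSpace P 𝔽 :=
  (1 : 𝔽) ⊗ₜ[ℤ] ((⟨P.root γ.1, root_mem_weightLattice γ.1⟩, γ.2) : weightLattice P × ℤ)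

theorem affineLabel_ne_zero {𝔽 : Type f} [Field 𝔽] (h2 : (2 : 𝔽) ≠ 0) (γ : ι × ℤ) :
    affineLabel P 𝔽 γ ≠ 0 := by
  intro h
  have hfl : ∀ x : weightLattice P, ((⌊P.toLinearMap x.1 (P.coroot γ.1)⌋ : ℤ) : ℚ) =
      P.toLinearMap x.1 (P.coroot γ.1) := by
    intro x
    obtain ⟨k, hk⟩ := x.2 γ.1
    rw [hk, Int.floor_intCast]
  let φ : (weightLattice P × ℤ) →+ ℤ := AddMonoidHom.mk'
    (fun x => ⌊P.toLinearMap x.1.1 (P.coroot γ.1)⌋) (by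
      intro x y
      have : ((⌊P.toLinearMap (x + y).1.1 (P.coroot γ.1)⌋ : ℤ) : ℚ) =
        ((⌊P.toLinearMap x.1.1 (P.coroot γ.1)⌋ + ⌊P.toLinearMap y.1.1 (P.coroot γ.1)⌋ : ℤ) : ℚ) := by
        push_cast
        rw [hfl, hfl, hfl]
        simp
      exact_mod_cast this)
  have hφ := congrArg (fun t => TensorProduct.rid ℤ 𝔽 (LinearMap.lTensor 𝔽 φ.toIntLinearMap t)) h
  simp only [affineLabel, LinearMap.lTensor_tmul, TensorProduct.rid_tmul, map_zero] at hφ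
  have hval : φ.toIntLinearMap (⟨P.root γ.1, root_mem_weightLattice γ.1⟩, γ.2) = 2 := by
    change ⌊P.toLinearMap (P.root γ.1) (P.coroot γ.1)⌋ = 2
    rw [P.root_coroot_two]
    norm_num
  rw [hval] at hφ
  apply h2
  simpa using hφ

/-- The edges of the affine moment graph: there is an edge from `x` to `y` if `x < y` in the
Bruhat order and `y = s_γ x` for a positive affine root `γ`. -/
structure AffineEdge where
  src : affineWeylGroup P
  tgt : affineWeylGroup P
  root : ι × ℤ
  pos : IsPosAffine b root
  tgt_eq : tgt = affineReflection P root * src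
  lt : (bruhatOrder (simpleReflections b)).lt src tgt

/-- The affine moment graph over a field of characteristic different from `2`. -/
noncomputable def affineMomentGraph {𝔽 : Type f} [Field 𝔽] (h2 : (2 : 𝔽) ≠ 0) :
    MomentGraph.{u, max f v, u, f} 𝔽 (LabelSpace P 𝔽) where
  Vertex := affineWeylGroup P
  order := bruhatOrder (simpleReflections b)
  Edge := AffineEdge b
  src := AffineEdge.src
  tgt := AffineEdge.tgt
  label E := affineLabel P 𝔽 E.root
  label_ne_zero E := affineLabel_ne_zero h2 E.root
  src_lt_tgt := AffineEdge.lt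

/-- The edges of the quotient graph: there is an edge from `x` to `y` if `x ≠ y` and there is
an edge of the affine moment graph from a representative of `x` to a representative of `y`. -/
structure QuotientEdge (s : affineWeylGroup P) where
  src : affineWeylGroup P ⧸ Subgroup.zpowers s
  tgt : affineWeylGroup P ⧸ Subgroup.zpowers s
  root : ι × ℤ
  ne : src ≠ tgt
  exists_edge : ∃ E : AffineEdge b, (E.src : affineWeylGroup P ⧸ Subgroup.zpowers s) = src ∧
    (E.tgt : affineWeylGroup P ⧸ Subgroup.zpowers s) = tgt ∧ E.root = root

variable [Finite ι] [P.IsRootSystem] [P.IsReduced]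

/-- The quotient moment graph, whose vertices are the left cosets of `{1, s}`. -/
noncomputable def quotientMomentGraph {𝔽 : Type f} [Field 𝔽] (h2 : (2 : 𝔽) ≠ 0)
    {s : affineWeylGroup P} (hs : s ∈ simpleReflections b) :
    MomentGraph.{u, max f v, u, f} 𝔽 (LabelSpace P 𝔽) where
  Vertex := affineWeylGroup P ⧸ Subgroup.zpowers s
  order := quotientOrder b hs
  Edge := QuotientEdge b s
  src := QuotientEdge.src
  tgt := QuotientEdge.tgt
  label E := affineLabel P 𝔽 E.root
  label_ne_zero E := affineLabel_ne_zero h2 E.root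
  src_lt_tgt E := by
    obtain ⟨F, h1, h2, -⟩ := E.exists_edge
    exact @lt_of_le_of_ne _ (quotientOrder b hs) _ _
      ⟨F.src, F.tgt, h1, h2, ((bruhatOrder (simpleReflections b)).lt_iff_le_not_ge _ _ |>.mp
        F.lt).1⟩ E.ne

/-! ### The translation functors -/

section Translation

variable {𝔽 : Type f} [Field 𝔽] {h2 : (2 : 𝔽) ≠ 0} {b}

/-- The coset `{x, x s}`, as a set of vertices of the affine moment graph. -/
def fiber (s : affineWeylGroup P) (q : affineWeylGroup P ⧸ Subgroup.zpowers s) :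
    Set (affineWeylGroup P) := {x | (x : affineWeylGroup P ⧸ Subgroup.zpowers s) = q}

theorem finite_fiber {s : affineWeylGroup P} (hs : s ∈ simpleReflections b)
    (q : affineWeylGroup P ⧸ Subgroup.zpowers s) : Finite (fiber s q) := by
  obtain ⟨x, rfl⟩ := QuotientGroup.mk_surjective q
  refine Set.Finite.subset (Set.toFinite {x, x * s}) fun y hy => ?_
  exact (mk_eq_iff b hs).mp hy.symm

/-- The edges of the affine moment graph over an edge of the quotient graph: the two
edges `E` and `E s`. -/
def EdgesOver {s : affineWeylGroup P} (F : QuotientEdge b s) : Type u :=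
  {E : AffineEdge b // (E.src : affineWeylGroup P ⧸ Subgroup.zpowers s) = F.src ∧
    (E.tgt : affineWeylGroup P ⧸ Subgroup.zpowers s) = F.tgt ∧ E.root = F.root}

theorem finite_edgesOver {s : affineWeylGroup P} (hs : s ∈ simpleReflections b)
    (F : QuotientEdge b s) : Finite (EdgesOver F) := by
  have := finite_fiber hs F.src
  refine Finite.of_injective (β := fiber s F.src) (fun E => ⟨E.1.src, E.2.1⟩) ?_
  rintro ⟨⟨x, y, r, h1, h2, h3⟩, h4, h5, h6⟩ ⟨⟨x', y', r', h1', h2', h3'⟩, h4', h5', h6'⟩ h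
  obtain rfl : x = x' := congrArg Subtype.val h
  dsimp only at h6 h6'
  subst h6 h6' h2 h2'
  rfl

namespace Sheaf

variable (M : Sheaf.{u, max f v, u, f, w} (affineMomentGraph b h2)) {s : affineWeylGroup P}
  (hs : s ∈ simpleReflections b)

/-- The stalk `Γ({x, x s}, M)` of `ϑ_on M`. -/
noncomputable def onStalk (q : affineWeylGroup P ⧸ Subgroup.zpowers s) :
    GradedMod.{max f v, f, max u w} 𝔽 (LabelSpace P 𝔽) :=
  @Sheaf.gradedSections _ _ _ _ _ _ M (fiber s q) (finite_fiber hs q)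

/-- The direct sum of the modules `M^E` and `M^{E s}`. -/
noncomputable def onEdgeSum (F : QuotientEdge b s) :
    GradedMod.{max f v, f, max u w} 𝔽 (LabelSpace P 𝔽) :=
  have : Finite (EdgesOver F) := finite_edgesOver hs F
  GradedMod.pi fun E : EdgesOver F => (M.edge E.1).mod

/-- The map from `Γ({x, x s}, M)` to `M^E ⊕ M^{E s}`, where `E` goes from `x` to `y`. -/
noncomputable def onSrc (F : QuotientEdge b s) :
    GradedHom (M.onStalk hs F.src) (M.onEdgeSum hs F) where
  toLin :=
    { toFun := fun m E => (M.edge E.1).rhoSrc.toLin (m.1 ⟨E.1.src, E.2.1⟩)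
      map_add' := fun m m' => funext fun E => map_add _ _ _
      map_smul' := fun a m => funext fun E => map_smul _ _ _ }
  map_deg i m hm E _ := (M.edge E.1).rhoSrc.map_deg i _ (hm ⟨E.1.src, E.2.1⟩ trivial)

/-- The map from `Γ({y, y s}, M)` to `M^E ⊕ M^{E s}`, where `E` goes from `x` to `y`. -/
noncomputable def onTgt (F : QuotientEdge b s) :
    GradedHom (M.onStalk hs F.tgt) (M.onEdgeSum hs F) where
  toLin :=
    { toFun := fun m E => (M.edge E.1).rhoTgt.toLin (m.1 ⟨E.1.tgt, E.2.2.1⟩)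
      map_add' := fun m m' => funext fun E => map_add _ _ _
      map_smul' := fun a m => funext fun E => map_smul _ _ _ }
  map_deg i m hm E _ := (M.edge E.1).rhoTgt.map_deg i _ (hm ⟨E.1.tgt, E.2.2.1⟩ trivial)

/-- The module that `ϑ_on M` attaches to an edge: the image of `Γ({y, y s}, M)` in
`M^E ⊕ M^{E s}`. -/
noncomputable def onEdge (F : QuotientEdge b s) :
    GradedMod.{max f v, f, max u w} 𝔽 (LabelSpace P 𝔽) :=
  (M.onEdgeSum hs F).sub (LinearMap.range (M.onTgt hs F).toLin) (by
    rintro _ ⟨m, rfl⟩ i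
    exact ⟨_, ((M.onTgt hs F).proj_apply i m).symm⟩)

/-- The sheaf `ϑ_on M` is well defined: for every edge `E` from `x` to `y`, the image
of `Γ({x, x s}, M)` in `M^E ⊕ M^{E s}` is contained in the image of `Γ({y, y s}, M)`. -/
def OnWellDefined : Prop :=
  ∀ (F : QuotientEdge b s) (m : M.onStalk hs F.src),
    (M.onSrc hs F).toLin m ∈ LinearMap.range (M.onTgt hs F).toLin

/-- The sheaf `ϑ_on M` on the quotient graph. -/
noncomputable def thetaOn (h : M.OnWellDefined hs) :
    Sheaf.{u, max f v, u, f, max u w} (quotientMomentGraph b h2 hs) where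
  stalk q := M.onStalk hs q
  edge F :=
    { mod := M.onEdge hs F
      label_smul := by
        rintro ⟨m, hm⟩
        refine Subtype.ext (funext fun E => ?_)
        have := (M.edge E.1).label_smul (m E)
        have hl : (affineMomentGraph b h2).label E.1 = (quotientMomentGraph b h2 hs).label F :=
          congrArg (affineLabel P 𝔽) E.2.2.2
        exact (congrArg (fun a => SymmetricAlgebra.ι 𝔽 (LabelSpace P 𝔽) a • m E) hl.symm).trans this
      rhoSrc := ⟨(M.onSrc hs F).toLin.codRestrict _ (h F), (M.onSrc hs F).map_deg⟩
      rhoTgt := ⟨(M.onTgt hs F).toLin.rangeRestrict, (M.onTgt hs F).map_deg⟩ }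

variable {hs}

/-- The datum `A / a A` of an edge whose two ends have the same stalk `A = N.stalk p`. -/
noncomputable def loopDatum (N : Sheaf.{u, max f v, u, f, w} (quotientMomentGraph b h2 hs))
    (a : LabelSpace P 𝔽) : ∀ {p q : affineWeylGroup P ⧸ Subgroup.zpowers s}, p = q →
      EdgeDatum (N.stalk p) (N.stalk q) a
  | p, _, rfl => EdgeDatum.modLabel (N.stalk p) a

open Classical in
/-- The sheaf `ϑ_out N` on the affine moment graph. -/
noncomputable def thetaOut (N : Sheaf.{u, max f v, u, f, w} (quotientMomentGraph b h2 hs)) :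
    Sheaf.{u, max f v, u, f, w} (affineMomentGraph b h2) where
  stalk x := N.stalk (QuotientGroup.mk x : affineWeylGroup P ⧸ Subgroup.zpowers s)
  edge E :=
    if h : (E.src : affineWeylGroup P ⧸ Subgroup.zpowers s) = E.tgt then
      N.loopDatum (affineLabel P 𝔽 E.root) h
    else
      N.edge (⟨E.src, E.tgt, E.root, h, E, rfl, rfl, rfl⟩ : QuotientEdge b s)

variable (hs)

/-- The modified translation functor `ϑ = ϑ_out ∘ ϑ_on` on sheaves. -/
noncomputable def theta (h : M.OnWellDefined hs) :
    Sheaf.{u, max f v, u, f, max u w} (affineMomentGraph b h2) :=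
  (M.thetaOn hs h).thetaOut

end Sheaf

end Translation

end AffineGraph

end MomentGraphs

/-! Write `c_w` for `wallLabel hs 𝔽 w`, the label of the image under `w` of the simple affine root
of `s`. Two facts drive the proof. First, `w ↦ c_w` changes along every edge by a multiple of the
label of that edge (`wallLabel_tgt`), so multiplication by `c` preserves sections of every sheaf.
Second, `c_{ws} = -c_w` (`wallLabel_mul_simple`), and up to sign `c_w` labels the edge between `w`
and `ws`. Since `2` is invertible, `c` separates the two points of a coset.

For `ϑ_on`: a compatible pair on `{x, xs}` extends to a global section. Extend its component at the
start of the wall edge; the error at the other end is divisible by the wall label; extend the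
quotient, and correct by its product with a multiple of `c_x - c_w`, which vanishes at the start
(`IsProjective.exists_section_pair`). Extension followed by restriction to another coset shows that
`ϑ_on` is well defined and generated by global sections. Its stalks are free, being extensions of
one stalk by a shift of the other. The kernel condition amounts to dividing a pair of elements by
the label of an edge; the quotients remain compatible because that label is not proportional to the
wall label, so it acts injectively on the module of the wall edge.

For `ϑ_out`: over a full coset a section has the form `x ↦ p + c_x k` (`exists_decomposition`). An
edge of the quotient has two lifts, whose wall labels at the end are opposite, so the failures `A`,
`B` of `p`, `k` to be sections satisfy `A + cB = A - cB = 0`. Hence `A = 0`, and `B = 0` by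
non-proportionality (`IsProjective.decomposition_mem_sections`). Thus `p` and `k` extend by
flabbiness on the quotient. After subtraction of this extension, what is left vanishes on the full
cosets in the open set, so it descends to the cosets meeting that set and extends once more
(`IsProjective.thetaOut_flabby`).

The GKM-property enters only through `IsProjective.labelsIndependent`. The combinatorial input is
that edges outside the cosets can be shifted by `s`; this needs every affine reflection to be
conjugate to a simple one and all lengths to be finite, which rests on the existence of the highest
root. -/

namespace MomentGraphs

/-! ### Divisibility by linear forms in `S(U)`, and free graded modules -/

section SymmetricAlgebraLemmas

variable {𝔽 : Type f} {U : Type v} [Field 𝔽] [AddCommGroup U] [Module 𝔽 U]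

/-- Extending `a` to a basis of `U` turns `S(U)` into a polynomial ring with `a` as one of the
variables. -/
theorem prime_ι {a : U} (ha : a ≠ 0) : Prime (SymmetricAlgebra.ι 𝔽 U a) := by
  have hs : LinearIndepOn 𝔽 id ({a} : Set U) := LinearIndepOn.singleton ha
  obtain ⟨i, hi⟩ : ∃ i, Module.Basis.extend hs i = a :=
    ⟨⟨a, hs.subset_extend _ rfl⟩, Module.Basis.extend_apply_self _ _⟩
  have h := MulEquiv.prime_iff (SymmetricAlgebra.equivMvPolynomial (Module.Basis.extend hs))
    (p := SymmetricAlgebra.ι 𝔽 U (Module.Basis.extend hs i))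
  rw [SymmetricAlgebra.equivMvPolynomial_ι_apply, hi] at h
  exact h.mp MvPolynomial.X_prime

/-- Here both vectors belong to a common basis and become different variables. -/
theorem not_ι_dvd_ι {a c : U} (ha : a ≠ 0) (hc : c ∉ Submodule.span 𝔽 {a}) :
    ¬ SymmetricAlgebra.ι 𝔽 U a ∣ SymmetricAlgebra.ι 𝔽 U c := by
  have hs : LinearIndepOn 𝔽 id (insert c {a} : Set U) :=
    (LinearIndepOn.singleton ha).id_insert hc
  obtain ⟨i, hi⟩ : ∃ i, Module.Basis.extend hs i = a :=
    ⟨⟨a, hs.subset_extend _ (by simp)⟩, Module.Basis.extend_apply_self _ _⟩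
  obtain ⟨j, hj⟩ : ∃ j, Module.Basis.extend hs j = c :=
    ⟨⟨c, hs.subset_extend _ (by simp)⟩, Module.Basis.extend_apply_self _ _⟩
  have h1 := SymmetricAlgebra.equivMvPolynomial_ι_apply (Module.Basis.extend hs) i
  have h2 := SymmetricAlgebra.equivMvPolynomial_ι_apply (Module.Basis.extend hs) j
  rw [hi] at h1
  rw [hj] at h2
  intro h
  have h' := map_dvd (SymmetricAlgebra.equivMvPolynomial (Module.Basis.extend hs)) h
  rw [h1, h2, MvPolynomial.X_dvd_X] at h'
  obtain rfl : i = j := by simpa using h'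
  exact hc (hj.symm.trans hi ▸ Submodule.mem_span_singleton_self _)

namespace GradedMod

variable {M : GradedMod.{v, f, w} 𝔽 U}

theorem IsFree.eq_zero_of_ι_smul (h : M.IsFree) {a : U} (ha : a ≠ 0) {m : M}
    (hm : SymmetricAlgebra.ι 𝔽 U a • m = 0) : m = 0 := by
  obtain ⟨n, r, φ, -⟩ := h
  obtain ⟨x, rfl⟩ := φ.surjective m
  rw [← map_smul, map_eq_zero_iff _ φ.injective] at hm
  rw [map_eq_zero_iff _ φ.injective]
  funext k
  exact (mul_eq_zero.mp (congrFun hm k)).resolve_left (prime_ι ha).ne_zero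

/-- Coordinatewise, the prime `a` divides a multiple of `c` but not `c` itself. In terms of modules,
`c` acts injectively on `M / aM`. -/
theorem IsFree.exists_eq_ι_smul (h : M.IsFree) {a c : U} (ha : a ≠ 0)
    (hc : c ∉ Submodule.span 𝔽 {a}) {m m' : M}
    (hm : SymmetricAlgebra.ι 𝔽 U c • m = SymmetricAlgebra.ι 𝔽 U a • m') :
    ∃ m'' : M, m = SymmetricAlgebra.ι 𝔽 U a • m'' := by
  obtain ⟨n, r, φ, -⟩ := h
  obtain ⟨x, rfl⟩ := φ.surjective m
  obtain ⟨x', rfl⟩ := φ.surjective m'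
  rw [← map_smul, ← map_smul, φ.injective.eq_iff] at hm
  have hd : ∀ k, SymmetricAlgebra.ι 𝔽 U a ∣ x k := fun k =>
    ((prime_ι ha).dvd_or_dvd ⟨x' k, congrFun hm k⟩).resolve_left (not_ι_dvd_ι ha hc)
  choose y hy using hd
  exact ⟨φ y, by rw [← map_smul]; exact congrArg φ (funext hy)⟩

theorem IsFree.subsingleton_of_divisible (h : M.IsFree) {a : U} (ha : a ≠ 0)
    (hM : ∀ m : M, ∃ m' : M, m = SymmetricAlgebra.ι 𝔽 U a • m') : Subsingleton M := by
  obtain ⟨n, r, φ, -⟩ := h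
  rcases isEmpty_or_nonempty (Fin n) with hE | ⟨⟨k⟩⟩
  · exact φ.symm.injective.subsingleton
  · exfalso
    -- Divisibility of the all-ones vector would make the prime `a` a unit.
    obtain ⟨m', hm'⟩ := hM (φ 1)
    obtain ⟨x, rfl⟩ := φ.surjective m'
    rw [← map_smul, φ.injective.eq_iff] at hm'
    exact (prime_ι ha).not_isUnit (IsUnit.of_mul_eq_one (x k) (congrFun hm' k).symm)

theorem IsFree.of_fintype {κ : Type} [Finite κ] (r : κ → ℤ)
    (φ : (κ → SymmetricAlgebra 𝔽 U) ≃ₗ[SymmetricAlgebra 𝔽 U] M)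
    (h : ∀ (j : ℤ) (a : κ → SymmetricAlgebra 𝔽 U),
      (∀ k, a k ∈ symDeg 𝔽 U (j + r k)) ↔ φ a ∈ M.deg j) : M.IsFree := by
  obtain ⟨n, ⟨e⟩⟩ := Finite.exists_equiv_fin κ
  refine ⟨n, r ∘ e.symm, (LinearEquiv.funCongrLeft _ _ e).trans φ, fun j a => ?_⟩
  rw [LinearEquiv.trans_apply, ← h]
  exact ⟨fun H k => by simpa [LinearEquiv.funCongrLeft] using H (e k), fun H k => by
    simpa [LinearEquiv.funCongrLeft] using H (e.symm k)⟩

variable (𝔽 U) in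
theorem one_mem_symDeg : (1 : SymmetricAlgebra 𝔽 U) ∈ symDeg 𝔽 U 0 := by
  simp [symDeg]

/-- An extension of a free graded module by a shifted free graded module is free. -/
theorem IsFree.of_extension {A : GradedMod.{v, f, w} 𝔽 U} {B : GradedMod.{v, f, u} 𝔽 U}
    {G : GradedMod.{v, f, e} 𝔽 U} (hA : A.IsFree) (hB : B.IsFree) (d : ℤ)
    (p : GradedHom G A) (hp : Function.Surjective p.toLin)
    (i : B →ₗ[SymmetricAlgebra 𝔽 U] G) (hi : Function.Injective i)
    (hdeg : ∀ j m, m ∈ B.deg j ↔ i m ∈ G.deg (j + d))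
    (hker : ∀ m, p.toLin m = 0 ↔ ∃ m', i m' = m) : G.IsFree := by
  classical
  obtain ⟨n, r, φ, hφ⟩ := hA
  obtain ⟨n', r', φ', hφ'⟩ := hB
  -- With the convention `S⟨r⟩ⱼ = Sⱼ₊ᵣ`, the basis vector with shift `r k` has degree `-r k`. Any
  -- lift of it can be replaced by its component of that degree, because `p` commutes with the
  -- projections.
  have hγ : ∀ k : Fin n, ∃ g ∈ G.deg (-r k), p.toLin g = φ (Pi.single k 1) := by
    intro k
    obtain ⟨g, hg⟩ := hp (φ (Pi.single k 1))
    refine ⟨G.proj (-r k) g, G.proj_mem _ _, ?_⟩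
    rw [← p.proj_apply, hg]
    refine A.proj_same ((hφ _ _).mp fun l => ?_)
    by_cases hl : l = k
    · subst hl
      simpa using one_mem_symDeg 𝔽 U
    · simp [hl]
  choose g hgdeg hg using hγ
  let σ : (Fin n → SymmetricAlgebra 𝔽 U) →ₗ[SymmetricAlgebra 𝔽 U] G :=
    Fintype.linearCombination (SymmetricAlgebra 𝔽 U) g
  have hσ : ∀ a, p.toLin (σ a) = φ a := by
    intro a
    have h1 : a = ∑ k, a k • (Pi.single k (1 : SymmetricAlgebra 𝔽 U) : Fin n → _) :=
      (pi_eq_sum_univ' a)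
    conv_rhs => rw [h1]
    simp [σ, Fintype.linearCombination_apply, map_sum, hg]
  let ψ : (Fin n ⊕ Fin n' → SymmetricAlgebra 𝔽 U) →ₗ[SymmetricAlgebra 𝔽 U] G :=
    (σ.coprod (i.comp φ'.toLinearMap)).comp
      (LinearEquiv.sumArrowLequivProdArrow _ _ _ _).toLinearMap
  have hψ : ∀ a, ψ a = σ (a ∘ Sum.inl) + i (φ' (a ∘ Sum.inr)) := fun a => rfl
  have hpψ : ∀ a, p.toLin (ψ a) = φ (a ∘ Sum.inl) := by
    intro a
    rw [hψ, map_add, hσ, (hker _).mpr ⟨_, rfl⟩, add_zero]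
  have hinj : Function.Injective ψ := by
    rw [injective_iff_map_eq_zero]
    intro a ha
    have h1 : a ∘ Sum.inl = 0 := by
      have := hpψ a
      rw [ha, map_zero] at this
      exact (map_eq_zero_iff _ φ.injective).mp this.symm
    rw [hψ, h1, map_zero, zero_add, map_eq_zero_iff _ hi, map_eq_zero_iff _ φ'.injective] at ha
    funext k
    rcases k with k | k
    · exact congrFun h1 k
    · exact congrFun ha k
  have hsurj : Function.Surjective ψ := by
    intro m
    obtain ⟨a, ha⟩ := φ.surjective (p.toLin m)
    obtain ⟨m', hm'⟩ := (hker (m - σ a)).mp (by rw [map_sub, hσ, ha, sub_self])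
    obtain ⟨a', rfl⟩ := φ'.surjective m'
    refine ⟨Sum.elim a a', ?_⟩
    rw [hψ, Sum.elim_comp_inl, Sum.elim_comp_inr, hm']
    abel
  -- The map `i` raises degrees by `d`, hence the shifts of `B` drop by `d`.
  refine IsFree.of_fintype (Sum.elim r fun k => r' k - d) (LinearEquiv.ofBijective ψ ⟨hinj, hsurj⟩)
    fun j a => ?_
  have hσdeg : (∀ k, a (Sum.inl k) ∈ symDeg 𝔽 U (j + r k)) → σ (a ∘ Sum.inl) ∈ G.deg j := by
    intro H
    simp only [σ, Fintype.linearCombination_apply]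
    refine AddSubgroup.sum_mem _ fun k _ => ?_
    have := G.smul_mem (H k) (hgdeg k)
    rwa [add_neg_cancel_right] at this
  have hB : (∀ k, a (Sum.inr k) ∈ symDeg 𝔽 U (j + (r' k - d))) ↔
      i (φ' (a ∘ Sum.inr)) ∈ G.deg j := by
    have h1 := hdeg (j - d) (φ' (a ∘ Sum.inr))
    rw [sub_add_cancel] at h1
    rw [← h1, ← hφ']
    simp only [Function.comp_apply, show ∀ k, j + (r' k - d) = j - d + r' k by intro k; ring]
  change _ ↔ ψ a ∈ G.deg j
  rw [hψ, Sum.forall]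
  simp only [Sum.elim_inl, Sum.elim_inr]
  constructor
  · rintro ⟨h1, h2⟩
    exact add_mem (hσdeg h1) (hB.mp h2)
  · intro H
    -- The coordinates over `A` are read off after applying `p`; the part coming from `B` is then a
    -- difference of two elements of degree `j`.
    have h1 : ∀ k, a (Sum.inl k) ∈ symDeg 𝔽 U (j + r k) := by
      refine (hφ j (a ∘ Sum.inl)).mpr ?_
      rw [← hpψ, hψ]
      exact p.map_deg _ _ H
    exact ⟨h1, hB.mpr (by simpa using sub_mem H (hσdeg h1))⟩

end GradedMod

end SymmetricAlgebraLemmas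

/-! ### Existence of the highest root -/

section HighestRoot

set_option linter.unusedSectionVars false

variable {ι N : Type u} {V : Type v} [Finite ι]
    [AddCommGroup V] [Module ℚ V] [AddCommGroup N] [Module ℚ N]
    {P : RootPairing ι ℚ V N} [P.IsRootSystem] [P.IsCrystallographic] [P.IsReduced]
    (b : P.Base)

theorem pairingIn_nonneg_comm (i j : ι) :
    0 ≤ P.pairingIn ℤ i j ↔ 0 ≤ P.pairingIn ℤ j i := by
  rw [← not_lt, ← not_lt, P.pairingIn_lt_zero_iff]

/-- A coroot that is nonnegative on the simple roots is nonnegative on their sums. -/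
theorem coroot'_nonneg_of_mem_closure {i : ι} (hi : ∀ k ∈ b.support, 0 ≤ P.pairingIn ℤ k i)
    {x : V} (hx : x ∈ AddSubmonoid.closure (P.root '' b.support)) : 0 ≤ P.coroot' i x := by
  induction hx using AddSubmonoid.closure_induction with
  | mem x hx =>
    obtain ⟨k, hk, rfl⟩ := hx
    rw [RootPairing.root_coroot'_eq_pairing, ← P.algebraMap_pairingIn ℤ k i]
    simpa using hi k hk
  | zero => simp
  | add x y _ _ hx hy => rw [map_add]; exact add_nonneg hx hy

/-- If `j` paired negatively with a simple root `k`, the reflection in `k` would add a positive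
multiple of `k` to `j`, giving a higher root above `j`. -/
theorem nonneg_pairingIn_of_maximal {j : ι}
    (hj : ∀ k, P.root k - P.root j ∈ AddSubmonoid.closure (P.root '' b.support) →
      b.height k ≤ b.height j) (k : ι) (hk : k ∈ b.support) : 0 ≤ P.pairingIn ℤ k j := by
  rw [pairingIn_nonneg_comm]
  by_contra! hlt
  have hr : P.root (P.reflectionPerm k j) = P.root j + (-P.pairingIn ℤ j k) • P.root k := by
    rw [P.root_reflectionPerm, neg_smul, P.reflection_apply_root' ℤ, sub_eq_add_neg]
  have h1 := hj (P.reflectionPerm k j) (by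
    rw [hr, add_sub_cancel_left]
    obtain ⟨n, hn⟩ := Int.eq_ofNat_of_zero_le (a := -P.pairingIn ℤ j k) (by omega)
    rw [hn, natCast_zsmul]
    exact AddSubmonoid.nsmul_mem _ (AddSubmonoid.subset_closure (Set.mem_image_of_mem _ hk)) _)
  rw [b.height_add_zsmul hr, RootPairing.Base.height_one_of_mem_support hk] at h1
  simp at h1
  omega

/-- The candidate is a root `θ` of maximal height. It is dominant and, by irreducibility, involves
every simple root, so it pairs strictly positively with every dominant root. A given root lies below
some root `j` of maximal height among those above it; such a `j` is dominant, and positivity of its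
pairing with `θ` forces `j = θ`. -/
theorem exists_isHighestRoot [P.IsIrreducible] [Nonempty ι] : ∃ θ, IsHighestRoot b θ := by
  classical
  obtain ⟨θ, hθ⟩ := Finite.exists_max (fun i => b.height i)
  have hθnn := nonneg_pairingIn_of_maximal b (j := θ) fun k _ => hθ k
  have hθpos : 0 < b.height θ := by
    have h1 := hθ (P.reflectionPerm θ θ)
    have h2 := b.height_reflectionPerm_self θ
    change b.height (P.reflectionPerm θ θ) = _ at h2
    have h3 := b.height_ne_zero θ
    omega
  obtain ⟨c, hcsupp, hc, hcθ⟩ := b.exists_root_eq_sum_int θ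
  have hc0 : 0 ≤ c := by
    rcases hc with hc | hc
    · exact hc.le
    · exfalso
      rw [RootPairing.Base.height_eq_sum hcθ] at hθpos
      exact absurd hθpos (not_lt.mpr (Finset.sum_nonpos fun k _ => hc.le k))
  -- all coefficients of the highest root are positive
  have hcpos : ∀ k ∈ b.support, 0 < c k := by
    let J : Set ι := {k | k ∈ b.support ∧ 0 < c k}
    let q : Submodule ℚ V := Submodule.span ℚ (P.root '' J)
    -- The pairing of `θ` with `k` is nonnegative by dominance, yet for `k` outside the support `J`
    -- of `θ` it is a sum of nonpositive terms. So all terms vanish, and the span of `J` is stable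
    -- under all reflections.
    have horth : ∀ k ∈ b.support, k ∉ J → ∀ j ∈ J, P.pairingIn ℤ j k = 0 := by
      intro k hk hkJ
      have h0 : 0 ≤ P.pairingIn ℤ θ k := (pairingIn_nonneg_comm _ _).mp (hθnn k hk)
      have h1 : P.pairingIn ℤ θ k = ∑ j ∈ b.support, c j * P.pairingIn ℤ j k := by
        have h2 := congrArg (P.coroot' k) hcθ
        rw [map_sum, RootPairing.root_coroot'_eq_pairing, ← P.algebraMap_pairingIn ℤ θ k] at h2
        have h3 : ∀ j, P.coroot' k (c j • P.root j) =
            ((c j * P.pairingIn ℤ j k : ℤ) : ℚ) := by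
          intro j
          rw [map_zsmul, RootPairing.root_coroot'_eq_pairing, ← P.algebraMap_pairingIn ℤ j k]
          simp
        simp only [h3] at h2
        have h4 : ((P.pairingIn ℤ θ k : ℤ) : ℚ) =
          ((∑ j ∈ b.support, c j * P.pairingIn ℤ j k : ℤ) : ℚ) := by push_cast; simpa using h2
        exact_mod_cast h4
      have hle : ∀ j ∈ b.support, c j * P.pairingIn ℤ j k ≤ 0 := by
        intro j hj
        by_cases hjk : j = k
        · subst hjk
          have : c j = 0 := le_antisymm (not_lt.mp fun h => hkJ ⟨hk, h⟩) (hc0 j)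
          simp [this]
        · exact mul_nonpos_of_nonneg_of_nonpos (hc0 j) (b.pairingIn_le_zero_of_ne hjk hj hk)
      rw [h1] at h0
      have h5 := (Finset.sum_eq_zero_iff_of_nonpos hle).mp
        (le_antisymm (Finset.sum_nonpos hle) h0)
      intro j hj
      exact (mul_eq_zero.mp (h5 j hj.1)).resolve_left hj.2.ne'
    have hq : ∀ i, q ∈ Module.End.invtSubmodule (P.reflection i).toLinearMap := by
      refine (b.forall_mem_support_invtSubmodule_iff q).mp fun k hk => ?_
      change q ≤ q.comap _
      refine Submodule.span_le.mpr ?_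
      rintro _ ⟨j, hj, rfl⟩
      change P.reflection k (P.root j) ∈ q
      have hjq : P.root j ∈ q := Submodule.subset_span ⟨j, hj, rfl⟩
      rw [P.reflection_apply_root' ℤ]
      by_cases hkJ : k ∈ J
      · exact sub_mem hjq (zsmul_mem (Submodule.subset_span (Set.mem_image_of_mem _ hkJ)) _)
      · rw [horth k hk hkJ j hj, zero_smul, sub_zero]
        exact hjq
    have hq0 : q ≠ ⊥ := by
      intro h
      obtain ⟨j, hj, hj0⟩ : ∃ j ∈ b.support, 0 < c j := by
        by_contra! hno
        rw [RootPairing.Base.height_eq_sum hcθ] at hθpos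
        exact absurd hθpos (not_lt.mpr (Finset.sum_nonpos hno))
      have : P.root j ∈ q := Submodule.subset_span ⟨j, ⟨hj, hj0⟩, rfl⟩
      rw [h, Submodule.mem_bot] at this
      exact P.ne_zero j this
    have htop := RootPairing.IsIrreducible.eq_top_of_invtSubmodule_reflection (P := P) q hq hq0
    intro k hk
    by_contra hck
    have hkJ : k ∉ J := fun h => hck h.2
    have hsub : (insert k J : Set ι) ⊆ b.support :=
      Set.insert_subset hk fun j hj => hj.1
    exact (b.linearIndepOn_root.mono hsub).notMem_span_of_insert hkJ
      (show P.root k ∈ q by rw [htop]; trivial)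
  have hpair : ∀ j, (∀ k ∈ b.support, 0 ≤ P.pairingIn ℤ k j) → 0 < P.pairingIn ℤ θ j := by
    intro j hj
    have h2 := congrArg (P.coroot' j) hcθ
    rw [map_sum, RootPairing.root_coroot'_eq_pairing, ← P.algebraMap_pairingIn ℤ θ j] at h2
    have h3 : ∀ k, P.coroot' j (c k • P.root k) = ((c k * P.pairingIn ℤ k j : ℤ) : ℚ) := by
      intro k
      rw [map_zsmul, RootPairing.root_coroot'_eq_pairing, ← P.algebraMap_pairingIn ℤ k j]
      simp
    simp only [h3] at h2
    have h4 : P.pairingIn ℤ θ j = ∑ k ∈ b.support, c k * P.pairingIn ℤ k j := by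
      have : ((P.pairingIn ℤ θ j : ℤ) : ℚ) =
        ((∑ k ∈ b.support, c k * P.pairingIn ℤ k j : ℤ) : ℚ) := by push_cast; simpa using h2
      exact_mod_cast this
    rw [h4]
    obtain ⟨k, hk, hk0⟩ := b.exists_mem_support_pos_pairingIn_ne_zero j
    exact Finset.sum_pos' (fun k hk => mul_nonneg (hcpos k hk).le (hj k hk))
      ⟨k, hk, mul_pos (hcpos k hk) (lt_of_le_of_ne (hj k hk) hk0.symm)⟩
  refine ⟨θ, fun i => ?_⟩
  let A : Set ι := {j | P.root j - P.root i ∈ AddSubmonoid.closure (P.root '' b.support)}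
  have hiA : i ∈ A := by
    change P.root i - P.root i ∈ AddSubmonoid.closure _
    rw [sub_self]
    exact zero_mem _
  obtain ⟨j, hjA, hj⟩ := Set.exists_max_image A (fun j => b.height j) A.toFinite ⟨i, hiA⟩
  have hup : ∀ k, P.root k - P.root j ∈ AddSubmonoid.closure (P.root '' b.support) →
      b.height k ≤ b.height j := by
    intro k hk
    refine hj k ?_
    have := add_mem hk hjA
    rwa [sub_add_sub_cancel] at this
  have hθj := hpair j (nonneg_pairingIn_of_maximal b hup)
  by_cases hne : θ = j
  · rw [hne]; exact hjA
  exfalso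
  -- The root `l = θ - j` has positive height, since `θ` has maximal height and no root has height
  -- zero. So `l` is a sum of simple roots, and `θ` lies strictly above `j`, against the choice of
  -- `j`.
  obtain ⟨l, hl⟩ := P.root_sub_root_mem_of_pairingIn_pos hθj hne
  have h1 := b.height_sub hl
  have h2 := hθ j
  have h3 := b.height_ne_zero l
  have h4 : P.root θ - P.root j ∈ AddSubmonoid.closure (P.root '' b.support) := by
    rw [← hl]
    rcases b.root_mem_or_neg_mem l with h | h
    · exact h
    · exfalso
      obtain ⟨ht, ht1, ht2⟩ := exists_height_functional b
      have h5 := (ht2 _ h).1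
      rw [map_neg, ht1] at h5
      have : b.height l ≤ 0 := by exact_mod_cast neg_nonneg.mp h5
      omega
  have h5 := hup θ h4
  omega

end HighestRoot

/-! ### Generation of the affine Weyl group by simple reflections, and finiteness of lengths -/

section Generation

set_option linter.unusedSectionVars false

variable {ι N : Type u} {V : Type v} [Finite ι]
    [AddCommGroup V] [Module ℚ V] [AddCommGroup N] [Module ℚ N]
    {P : RootPairing ι ℚ V N} [P.IsRootSystem] [P.IsCrystallographic] [P.IsReduced]
    [P.IsIrreducible] (b : P.Base)

/-- If no simple root pairs positively with `i`, then `-i` is dominant. As `θ` lies above `-i`, its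
pairing with the coroot of `-i` is at least `2`, so `-θ` pairs positively with `i`. The last clause
says that the affine height `(α, n) ↦ ht α + n (ht θ + 1)` takes the value `1` on the chosen simple
affine root. -/
theorem exists_simple_pairingIn_pos {θ : ι} (hθ : IsHighestRoot b θ) (i : ι) :
    ∃ δ ∈ simpleAffineRoots b, 0 < P.pairingIn ℤ i δ.1 ∧
      b.height δ.1 + δ.2 * (b.height θ + 1) = 1 := by
  by_cases hk : ∃ k ∈ b.support, 0 < P.pairingIn ℤ i k
  · obtain ⟨k, hk, h⟩ := hk
    exact ⟨(k, 0), Or.inl ⟨hk, rfl⟩, h, by simp [RootPairing.Base.height_one_of_mem_support hk]⟩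
  push Not at hk
  refine ⟨(P.reflectionPerm θ θ, 1), Or.inr ⟨θ, hθ, ?_, rfl⟩, ?_, ?_⟩
  · rw [P.root_reflectionPerm, P.reflection_apply_self]
  · rw [P.pairingIn_reflectionPerm_self_right, neg_pos, ← P.pairingIn_lt_zero_iff]
    have hneg : ∀ k ∈ b.support, 0 ≤ P.pairingIn ℤ k (P.reflectionPerm i i) := by
      intro k hkb
      rw [P.pairingIn_reflectionPerm_self_right, neg_nonneg, ← not_lt, P.zero_lt_pairingIn_iff',
        not_lt]
      exact hk k hkb
    have h1 := coroot'_nonneg_of_mem_closure b hneg (hθ (P.reflectionPerm i i))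
    rw [map_sub, RootPairing.root_coroot'_eq_pairing, RootPairing.root_coroot'_eq_pairing,
      ← P.algebraMap_pairingIn ℤ, ← P.algebraMap_pairingIn ℤ, P.pairingIn_same,
      P.pairingIn_reflectionPerm_self_right] at h1
    simp only [algebraMap_int_eq, eq_intCast] at h1
    have h2 : (0 : ℤ) ≤ -P.pairingIn ℤ θ i - 2 := by exact_mod_cast h1
    omega
  · have h2 := b.height_reflectionPerm_self θ
    change b.height (P.reflectionPerm θ θ) = _ at h2
    rw [h2]
    ring

/-- Every affine reflection is conjugate to a simple reflection under the group generated by the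
simple reflections. -/
theorem exists_conj_simple_of_pos {γ : ι × ℤ} (hγ : IsPosAffine b γ) :
    ∃ g ∈ Subgroup.closure (simpleReflections b), ∃ t ∈ simpleReflections b,
      affineReflection P γ = g * t * g⁻¹ := by
  have : Nonempty ι := ⟨γ.1⟩
  obtain ⟨θ, hθ⟩ := exists_isHighestRoot b
  -- The affine height is positive on positive affine roots, because heights of roots are at least
  -- `-ht θ`.
  have hpos : ∀ γ, IsPosAffine b γ → 0 < b.height γ.1 + γ.2 * (b.height θ + 1) := by
    rintro ⟨i, n⟩ h
    have h1 := (height_le_of_isHighest b hθ (P.reflectionPerm i i)).1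
    have h2 := b.height_reflectionPerm_self i
    change b.height (P.reflectionPerm i i) = _ at h2
    have h3 := isPos_of_isHighest b hθ
    rw [RootPairing.Base.isPos_iff] at h3
    rcases h with h | ⟨h, h'⟩
    · dsimp only at h ⊢
      nlinarith
    · rw [RootPairing.Base.isPos_iff] at h'
      dsimp only at h h' ⊢
      rw [h]
      omega
  obtain ⟨n, hn⟩ := Int.eq_ofNat_of_zero_le (hpos γ hγ).le
  induction n using Nat.strong_induction_on generalizing γ with
  | _ n ih =>
    -- Induction on the affine height: unless `γ = δ`, reflecting `γ` in `δ` keeps it positive and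
    -- lowers its affine height by the positive integer `P.pairingIn ℤ γ.1 δ.1`.
    obtain ⟨δ, hδ, h1, h2⟩ := exists_simple_pairingIn_pos b hθ γ.1
    by_cases hne : γ = δ
    · exact ⟨1, one_mem _, _, ⟨δ, hδ, rfl⟩, by rw [hne]; group⟩
    have hpos' := isPosAffine_reflectAffine b hδ hγ hne
    have hr : P.root (P.reflectionPerm δ.1 γ.1) =
        P.root γ.1 + (-P.pairingIn ℤ γ.1 δ.1) • P.root δ.1 := by
      rw [P.root_reflectionPerm, neg_smul, P.reflection_apply_root' ℤ, sub_eq_add_neg]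
    have h3 := b.height_add_zsmul hr
    have h4 : b.height (reflectAffine P δ γ).1 + (reflectAffine P δ γ).2 * (b.height θ + 1) =
        n - P.pairingIn ℤ γ.1 δ.1 := by
      change b.height (P.reflectionPerm δ.1 γ.1) +
        (γ.2 - P.pairingIn ℤ γ.1 δ.1 * δ.2) * (b.height θ + 1) = _
      rw [h3, smul_eq_mul]
      linear_combination hn - P.pairingIn ℤ γ.1 δ.1 * h2
    have h5 := hpos _ hpos'
    obtain ⟨m, hm⟩ := Int.eq_ofNat_of_zero_le h5.le
    obtain ⟨g, hg, t, ht, h6⟩ := ih m (by omega) hpos' hm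
    refine ⟨affineReflection P δ * g, mul_mem (Subgroup.subset_closure ⟨δ, hδ, rfl⟩) hg, t, ht, ?_⟩
    have h7 := affineReflection_conj P δ γ
    rw [h6] at h7
    calc affineReflection P γ = (affineReflection P δ)⁻¹ * (affineReflection P δ *
          affineReflection P γ * (affineReflection P δ)⁻¹) * affineReflection P δ := by group
      _ = _ := by
        rw [h7, affineReflection_inv, mul_inv_rev, affineReflection_inv]
        group

theorem exists_conj_simple (γ : ι × ℤ) :
    ∃ g ∈ Subgroup.closure (simpleReflections b), ∃ t ∈ simpleReflections b,
      affineReflection P γ = g * t * g⁻¹ := by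
  by_cases h : IsPosAffine b γ
  · exact exists_conj_simple_of_pos b h
  · rw [← affineReflection_neg]
    exact exists_conj_simple_of_pos b ((isPosAffine_neg b γ).mpr h)

theorem closure_simpleReflections : Subgroup.closure (simpleReflections b) = ⊤ := by
  rw [eq_top_iff]
  rintro ⟨g, hg⟩ -
  induction hg using Subgroup.closure_induction with
  | mem g hg =>
    obtain ⟨γ, rfl⟩ := hg
    obtain ⟨g, hg, t, ht, h⟩ := exists_conj_simple b γ
    change affineReflection P γ ∈ _
    rw [h]
    exact mul_mem (mul_mem hg (Subgroup.subset_closure ht)) (inv_mem hg)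
  | one => exact one_mem _
  | mul g h hg hh ihg ihh => exact mul_mem ihg ihh
  | inv g hg ih => exact inv_mem ih

theorem wordLength_ne_top (g : affineWeylGroup P) : wordLength (simpleReflections b) g ≠ ⊤ := by
  have hg : g ∈ Subgroup.closure (simpleReflections b) := by
    rw [closure_simpleReflections]; trivial
  induction hg using Subgroup.closure_induction_right with
  | one =>
    have := wordLength_le (S := simpleReflections b) (l := []) (by simp)
    exact ne_top_of_le_ne_top (ENat.natCast_ne_top _) this
  | mul_right x hx y hy ih => exact wordLength_mul_ne_top hy ih
  | mul_inv_cancel x hx y hy ih =>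
    rw [inv_eq_of_mul_eq_one_left (mul_simple_self b hy)]
    exact wordLength_mul_ne_top hy ih

theorem bruhatStep_of_lt {γ : ι × ℤ} {x : affineWeylGroup P}
    (h : wordLength (simpleReflections b) x <
      wordLength (simpleReflections b) (affineReflection P γ * x)) :
    BruhatStep (simpleReflections b) x (affineReflection P γ * x) := by
  obtain ⟨g, -, t, ht, hg⟩ := exists_conj_simple b γ
  exact ⟨⟨g, t, ht, by rw [hg]⟩, h⟩

theorem lt_of_bruhatStep {x y : affineWeylGroup P}
    (h : BruhatStep (simpleReflections b) x y) : (bruhatOrder (simpleReflections b)).lt x y := by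
  refine ((bruhatOrder (simpleReflections b)).lt_iff_le_not_ge _ _).mpr ⟨.single h, fun h' => ?_⟩
  rcases eq_or_length_lt h' with rfl | h'
  · exact lt_irrefl _ h.2
  · exact lt_asymm h.2 h'

theorem wordLength_lt_of_lt {x y : affineWeylGroup P}
    (h : (bruhatOrder (simpleReflections b)).lt x y) :
    wordLength (simpleReflections b) x < wordLength (simpleReflections b) y := by
  obtain ⟨h1, h2⟩ := ((bruhatOrder (simpleReflections b)).lt_iff_le_not_ge _ _).mp h
  rcases eq_or_length_lt h1 with rfl | h1
  · exact absurd Relation.ReflTransGen.refl h2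
  · exact h1

/-- The order relation in an edge is a priori only a chain of steps. Length grows along the chain,
and the reflection of the edge is conjugate to a simple one, so the edge itself is a single step. -/
theorem AffineEdge.bruhatStep {b : P.Base} (E : AffineEdge b) :
    BruhatStep (simpleReflections b) E.src E.tgt := by
  have h := wordLength_lt_of_lt b E.lt
  rw [E.tgt_eq] at h ⊢
  exact bruhatStep_of_lt b h

end Generation

/-! ### Wall labels, and the shift of edges by `s` -/

section Walls

set_option linter.unusedSectionVars false

variable {ι N : Type u} {V : Type v} [Finite ι]
    [AddCommGroup V] [Module ℚ V] [AddCommGroup N] [Module ℚ N]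
    {P : RootPairing ι ℚ V N} [P.IsRootSystem] [P.IsCrystallographic] [P.IsReduced]
    [P.IsIrreducible] {b : P.Base} {s : affineWeylGroup P} (hs : s ∈ simpleReflections b)

/-- Comparing the displacements of points shows that the two coroots are parallel, hence equal up to
sign as the system is reduced; the affine functionals then agree up to the same sign. -/
theorem affineReflection_inj {γ δ : ι × ℤ} (h : affineReflection P γ = affineReflection P δ) :
    γ = δ ∨ γ = negAffine P δ := by
  have key : ∀ x, affineEval P γ x • P.coroot γ.1 = affineEval P δ x • P.coroot δ.1 := by
    intro x
    have h1 := congrArg (fun g : affineWeylGroup P => g.1 x) h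
    exact sub_right_injective h1
  -- The values of the functional at `0` and at the coroot differ by `2`, so they are not both zero.
  obtain ⟨x, hx⟩ : ∃ x, affineEval P γ x ≠ 0 := by
    by_contra! hno
    have h1 := hno 0
    have h2 := hno (P.coroot γ.1)
    simp only [affineEval, map_zero, zero_add, RootPairing.root_coroot_two] at h1 h2
    rw [h1] at h2
    norm_num at h2
  have hdep : ¬ LinearIndependent ℚ ![P.coroot γ.1, P.coroot δ.1] := by
    intro hli
    have := (LinearIndependent.pair_iff.mp hli) (affineEval P γ x) (-affineEval P δ x)
      (by rw [key x]; module)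
    exact hx this.1
  have hδ : affineEval P δ = affineEval P γ ∨ affineEval P δ = - affineEval P γ := by
    rcases RootPairing.IsReduced.eq_or_eq_neg (P := P.flip) _ _ hdep with h1 | h1
    · left
      funext x
      have h2 := key x
      rw [show P.coroot γ.1 = P.coroot δ.1 from h1] at h2
      exact (smul_left_injective ℚ (P.flip.ne_zero δ.1) h2).symm
    · right
      funext x
      have h2 := key x
      rw [show P.coroot γ.1 = -P.coroot δ.1 from h1, smul_neg, ← neg_smul] at h2
      exact (smul_left_injective ℚ (P.flip.ne_zero δ.1) h2).symm
  rcases hδ with h1 | h1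
  · exact Or.inl (affineEval_injective P fun x => (congrFun h1 x).symm)
  · refine Or.inr (affineEval_injective P fun x => ?_)
    rw [affineEval_neg, congrFun h1 x]
    simp

/-- The image under `w` of the affine root of the simple reflection `s`. -/
noncomputable def wallRoot (w : affineWeylGroup P) : ι × ℤ :=
  (exists_sendsRoot P w hs.choose).choose

theorem sendsRoot_wallRoot (w : affineWeylGroup P) : SendsRoot P w hs.choose (wallRoot hs w) :=
  (exists_sendsRoot P w hs.choose).choose_spec

theorem wallRoot_mul_simple (w : affineWeylGroup P) :
    wallRoot hs (w * s) = negAffine P (wallRoot hs w) := by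
  have h1 := sendsRoot_reflection P hs.choose hs.choose
  rw [reflectAffine_self, hs.choose_spec.2] at h1
  exact (sendsRoot_wallRoot hs (w * s)).unique ((sendsRoot_neg P (sendsRoot_wallRoot hs w)).mul h1)

theorem wallRoot_reflection_mul (δ : ι × ℤ) (w : affineWeylGroup P) :
    wallRoot hs (affineReflection P δ * w) = reflectAffine P δ (wallRoot hs w) :=
  (sendsRoot_wallRoot hs _).unique ((sendsRoot_reflection P δ _).mul (sendsRoot_wallRoot hs w))

theorem affineReflection_wallRoot (w : affineWeylGroup P) :
    affineReflection P (wallRoot hs w) * w = w * s := by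
  rw [← (sendsRoot_wallRoot hs w).2, hs.choose_spec.2]
  group

theorem mul_simple_mul_simple (hs : s ∈ simpleReflections b) (w : affineWeylGroup P) :
    w * s * s = w := by
  rw [mul_assoc, mul_simple_self b hs, mul_one]

theorem mk_mul_simple (s w : affineWeylGroup P) :
    ((w * s : affineWeylGroup P) : affineWeylGroup P ⧸ Subgroup.zpowers s) = w := by
  rw [QuotientGroup.eq]
  simp

variable (𝔽 : Type f) [Field 𝔽]

theorem affineLabel_neg (γ : ι × ℤ) :
    affineLabel P 𝔽 (negAffine P γ) = -affineLabel P 𝔽 γ := by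
  rw [affineLabel, affineLabel, ← TensorProduct.tmul_neg]
  congr 1
  refine Prod.ext (Subtype.ext ?_) rfl
  simp [negAffine, P.root_reflectionPerm]

theorem affineLabel_reflectAffine (δ γ : ι × ℤ) :
    affineLabel P 𝔽 (reflectAffine P δ γ) =
      affineLabel P 𝔽 γ - (P.pairingIn ℤ γ.1 δ.1 : 𝔽) • affineLabel P 𝔽 δ := by
  rw [Int.cast_smul_eq_zsmul, affineLabel, affineLabel, affineLabel, ← TensorProduct.tmul_smul,
    ← TensorProduct.tmul_sub]
  congr 1
  refine Prod.ext (Subtype.ext ?_) ?_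
  · simp [reflectAffine, P.root_reflectionPerm, P.reflection_apply_root' ℤ]
  · simp [reflectAffine]

/-- The label of the edge between `w` and `w s`, up to sign. -/
noncomputable def wallLabel (w : affineWeylGroup P) : LabelSpace P 𝔽 :=
  affineLabel P 𝔽 (wallRoot hs w)

theorem wallLabel_mul_simple (w : affineWeylGroup P) :
    wallLabel hs 𝔽 (w * s) = -wallLabel hs 𝔽 w := by
  rw [wallLabel, wallLabel, wallRoot_mul_simple, affineLabel_neg]

/-- Passing along an edge reflects the wall root in the root of the edge. Hence the wall labels form
a degree two section of the structure sheaf. -/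
theorem wallLabel_tgt (E : AffineEdge b) :
    ∃ t : 𝔽, wallLabel hs 𝔽 E.tgt = wallLabel hs 𝔽 E.src + t • affineLabel P 𝔽 E.root := by
  rw [E.tgt_eq, wallLabel, wallLabel, wallRoot_reflection_mul, affineLabel_reflectAffine]
  exact ⟨-(P.pairingIn ℤ (wallRoot hs E.src).1 E.root.1 : 𝔽), by module⟩

theorem AffineEdge.tgt_eq_of_mk_eq (E : AffineEdge b)
    (hs : s ∈ simpleReflections b)
    (h : (E.src : affineWeylGroup P ⧸ Subgroup.zpowers s) = E.tgt) : E.tgt = E.src * s := by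
  rcases (mk_eq_iff b hs).mp h with h | h
  · exfalso
    have := E.bruhatStep.2
    rw [h] at this
    exact lt_irrefl _ this
  · exact h

/-- The sign is unavoidable: the root of an edge is positive, whereas the wall root need not be. -/
theorem affineLabel_of_mk_eq (E : AffineEdge b)
    (h : (E.src : affineWeylGroup P ⧸ Subgroup.zpowers s) = E.tgt) :
    affineLabel P 𝔽 E.root = wallLabel hs 𝔽 E.src ∨
      affineLabel P 𝔽 E.root = -wallLabel hs 𝔽 E.src := by
  have h1 := E.tgt_eq_of_mk_eq hs h
  rw [E.tgt_eq, ← affineReflection_wallRoot hs] at h1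
  rcases affineReflection_inj (mul_right_cancel h1) with h2 | h2
  · exact Or.inl (by rw [h2, wallLabel])
  · exact Or.inr (by rw [h2, affineLabel_neg, wallLabel])

theorem exists_edge_to_mul_simple (hs : s ∈ simpleReflections b)
    {x : affineWeylGroup P}
    (h : wordLength (simpleReflections b) x < wordLength (simpleReflections b) (x * s)) :
    ∃ E : AffineEdge b, E.src = x ∧ E.tgt = x * s := by
  have hlt := lt_of_bruhatStep b (bruhatStep_simple b hs h)
  by_cases hp : IsPosAffine b (wallRoot hs x)
  · exact ⟨⟨x, x * s, wallRoot hs x, hp, (affineReflection_wallRoot hs x).symm, hlt⟩, rfl, rfl⟩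
  · exact ⟨⟨x, x * s, negAffine P (wallRoot hs x), (isPosAffine_neg b _).mpr hp,
      by rw [affineReflection_neg, affineReflection_wallRoot], hlt⟩, rfl, rfl⟩

theorem wordLength_lt_or_gt (hs : s ∈ simpleReflections b) (x : affineWeylGroup P) :
    wordLength (simpleReflections b) x < wordLength (simpleReflections b) (x * s) ∨
      wordLength (simpleReflections b) (x * s) < wordLength (simpleReflections b) (x * s * s) := by
  rw [mul_simple_mul_simple hs]
  exact lt_or_gt_of_ne (wordLength_mul_simple_ne b hs (wordLength_ne_top b x)).symm

/-- By the exchange argument in `bruhatStep_shift`, a step can fail to shift only when it is right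
multiplication by `s`, which stays inside a coset. -/
theorem AffineEdge.exists_shift (E : AffineEdge b)
    (hs : s ∈ simpleReflections b)
    (h : (E.src : affineWeylGroup P ⧸ Subgroup.zpowers s) ≠ E.tgt) :
    ∃ E' : AffineEdge b, E'.src = E.src * s ∧ E'.tgt = E.tgt * s ∧ E'.root = E.root := by
  rcases bruhatStep_shift b hs E.bruhatStep with h1 | h1
  · exact absurd ((mk_eq_iff b hs).mpr (Or.inr h1)) h
  · exact ⟨⟨E.src * s, E.tgt * s, E.root, E.pos, by rw [E.tgt_eq, mul_assoc],
      lt_of_bruhatStep b h1⟩, rfl, rfl, rfl⟩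

end Walls

/-! ### Sheaves on arbitrary moment graphs -/

section GeneralSheaves

variable {𝔽 : Type f} {U : Type v} [Field 𝔽] [AddCommGroup U] [Module 𝔽 U]

theorem notMem_span_singleton_comm {x y : U} (hy : y ≠ 0) (h : x ∉ Submodule.span 𝔽 {y}) :
    y ∉ Submodule.span 𝔽 {x} := by
  intro h'
  obtain ⟨t, rfl⟩ := Submodule.mem_span_singleton.mp h'
  have ht : t ≠ 0 := fun ht => hy (by rw [ht, zero_smul])
  exact h (Submodule.mem_span_singleton.mpr ⟨t⁻¹, by rw [smul_smul, inv_mul_cancel₀ ht, one_smul]⟩)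

theorem EdgeDatum.ι_add_smul {A B : GradedMod.{v, f, w} 𝔽 U} {a : U} (D : EdgeDatum A B a)
    (c : U) (t : 𝔽) (m : D.mod) :
    SymmetricAlgebra.ι 𝔽 U (c + t • a) • m = SymmetricAlgebra.ι 𝔽 U c • m := by
  rw [map_add, map_smul, add_smul, Algebra.smul_def, mul_smul, D.label_smul, smul_zero, add_zero]

/-- On the module of an edge only the class of `c` modulo the label `a` matters, so `c` may be
replaced by `c'`. The two differences in the conclusion measure how far `p` and `k` are from being
compatible along the edge. -/
theorem EdgeDatum.compat_twisted {A B : GradedMod.{v, f, w} 𝔽 U} {a : U} (D : EdgeDatum A B a)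
    {c c' : U} {t : 𝔽} (hc : c' = c + t • a) (p k : A) (p' k' : B)
    (h : D.rhoSrc.toLin (p + SymmetricAlgebra.ι 𝔽 U c • k) =
      D.rhoTgt.toLin (p' + SymmetricAlgebra.ι 𝔽 U c' • k')) :
    (D.rhoSrc.toLin p - D.rhoTgt.toLin p') +
      SymmetricAlgebra.ι 𝔽 U c' • (D.rhoSrc.toLin k - D.rhoTgt.toLin k') = 0 := by
  rw [map_add, map_add, map_smul, map_smul] at h
  have hk : SymmetricAlgebra.ι 𝔽 U c' • D.rhoSrc.toLin k =
      SymmetricAlgebra.ι 𝔽 U c • D.rhoSrc.toLin k := by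
    rw [hc, D.ι_add_smul]
  rw [smul_sub, hk, sub_add_sub_comm, sub_eq_zero]
  exact h

namespace Sheaf

variable {G : MomentGraph.{u, v, e, f} 𝔽 U} {M : Sheaf.{u, v, e, f, w} G}

theorem rhoTgt_ι_label_smul (M : Sheaf.{u, v, e, f, w} G) (E : G.Edge) (m : M.stalk (G.tgt E)) :
    (M.edge E).rhoTgt.toLin (SymmetricAlgebra.ι 𝔽 U (G.label E) • m) = 0 := by
  rw [map_smul, EdgeDatum.label_smul]

/-- Multiplication of a section by a section of degree two of the structure sheaf. -/
theorem ι_smul_mem_sections {I : Set G.Vertex} (z : G.Vertex → U)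
    (hz : ∀ E, ∃ t : 𝔽, z (G.tgt E) = z (G.src E) + t • G.label E)
    {m : ∀ x : I, M.stalk x} (hm : m ∈ M.sections I) :
    (fun x : I => SymmetricAlgebra.ι 𝔽 U (z x) • m x) ∈ M.sections I := by
  intro E hx hy
  obtain ⟨t, ht⟩ := hz E
  rw [map_smul, map_smul, hm E hx hy]
  change _ = SymmetricAlgebra.ι 𝔽 U (z (G.tgt E)) • _
  rw [ht, EdgeDatum.ι_add_smul]

/-- Extend `a` to a section `n`. Its error at the end of `E` lies in the kernel of the restriction
to `E`, so it is the label times some `d`. Adding `z` times an extension of `d` repairs the end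
without disturbing the start. -/
theorem IsProjective.exists_section_pair (hM : M.IsProjective) (E : G.Edge) (z : G.Vertex → U)
    (hz : ∀ E, ∃ t : 𝔽, z (G.tgt E) = z (G.src E) + t • G.label E)
    (hz0 : z (G.src E) = 0) (hz1 : z (G.tgt E) = G.label E)
    (a : M.stalk (G.src E)) (c : M.stalk (G.tgt E))
    (hac : (M.edge E).rhoSrc.toLin a = (M.edge E).rhoTgt.toLin c) :
    ∃ n ∈ M.sections Set.univ, n ⟨G.src E, trivial⟩ = a ∧ n ⟨G.tgt E, trivial⟩ = c := by
  obtain ⟨n, hn, hna⟩ := hM.generated _ a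
  obtain ⟨d, hd⟩ := (hM.ker E (c - n ⟨G.tgt E, trivial⟩)).mp (by
    rw [map_sub, ← hac, ← hna, hn E trivial trivial, sub_self])
  obtain ⟨n', hn', hnd⟩ := hM.generated _ d
  refine ⟨_, add_mem hn (ι_smul_mem_sections z hz hn'), ?_, ?_⟩
  · change n ⟨G.src E, trivial⟩ +
      SymmetricAlgebra.ι 𝔽 U (z (G.src E)) • n' ⟨G.src E, trivial⟩ = a
    rw [hz0, map_zero, zero_smul, add_zero, hna]
  · change n ⟨G.tgt E, trivial⟩ +
      SymmetricAlgebra.ι 𝔽 U (z (G.tgt E)) • n' ⟨G.tgt E, trivial⟩ = c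
    rw [hz1, hnd, ← hd, add_sub_cancel]

/-- Restriction to the start of `E` is surjective; its kernel consists of the multiples of the label
in the stalk at the end, which is that stalk shifted by `2`. -/
theorem IsProjective.isFree_gradedSections (hM : M.IsProjective) (E : G.Edge) (I : Set G.Vertex)
    (hfin : Finite I) (hx : G.src E ∈ I) (hy : G.tgt E ∈ I)
    (hI : ∀ x ∈ I, x = G.src E ∨ x = G.tgt E)
    (hE : ∀ E', G.src E' ∈ I → G.tgt E' ∈ I → E' = E)
    (hext : ∀ (a : M.stalk (G.src E)) (c : M.stalk (G.tgt E)),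
      (M.edge E).rhoSrc.toLin a = (M.edge E).rhoTgt.toLin c →
      ∃ n ∈ M.sections Set.univ, n ⟨G.src E, trivial⟩ = a ∧ n ⟨G.tgt E, trivial⟩ = c) :
    (M.gradedSections I).IsFree := by
  classical
  have hne : (⟨G.src E, hx⟩ : I) ≠ ⟨G.tgt E, hy⟩ := fun h =>
    (G.src_lt_tgt E).ne (congrArg Subtype.val h)
  let S := SymmetricAlgebra 𝔽 U
  let a : S := SymmetricAlgebra.ι 𝔽 U (G.label E)
  let p : GradedHom (M.gradedSections I) (M.stalk (G.src E)) :=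
    { toLin := (LinearMap.proj (R := S) (φ := fun x : I => M.stalk x) ⟨G.src E, hx⟩).comp
        (M.sections I).subtype
      map_deg := fun i m hm => hm ⟨G.src E, hx⟩ trivial }
  let i₀ : M.stalk (G.tgt E) →ₗ[S] (∀ x : I, M.stalk x) :=
    (LinearMap.single S (fun x : I => M.stalk x) ⟨G.tgt E, hy⟩).comp (LinearMap.lsmul S _ a)
  have hi₀ : ∀ m, i₀ m ⟨G.tgt E, hy⟩ = a • m := fun m => Pi.single_eq_same _ _
  have hi₀' : ∀ m, i₀ m ⟨G.src E, hx⟩ = 0 := fun m => Pi.single_eq_of_ne hne _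
  have hmem : ∀ m, i₀ m ∈ M.sections I := by
    intro m E' hx' hy'
    obtain rfl := hE E' hx' hy'
    rw [hi₀, hi₀', map_zero, map_smul]
    exact ((M.edge E').label_smul _).symm
  let i : M.stalk (G.tgt E) →ₗ[S] M.gradedSections I := i₀.codRestrict (M.sections I) hmem
  have hext' : ∀ m m' : M.sections I, m.1 ⟨G.src E, hx⟩ = m'.1 ⟨G.src E, hx⟩ →
      m.1 ⟨G.tgt E, hy⟩ = m'.1 ⟨G.tgt E, hy⟩ → m = m' := by
    intro m m' h1 h2
    refine Subtype.ext (funext fun ⟨x, hxI⟩ => ?_)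
    rcases hI x hxI with rfl | rfl
    · exact h1
    · exact h2
  refine GradedMod.IsFree.of_extension (hM.free (G.src E)) (hM.free (G.tgt E)) 2 p ?_ i ?_ ?_ ?_
  · intro m
    obtain ⟨c, hc⟩ := hM.surjective E ((M.edge E).rhoSrc.toLin m)
    obtain ⟨n, hn, h1, -⟩ := hext m c hc.symm
    exact ⟨⟨fun x => n ⟨x, trivial⟩, fun E' _ _ => hn E' trivial trivial⟩, h1⟩
  · rw [injective_iff_map_eq_zero]
    intro m hm
    refine (hM.free _).eq_zero_of_ι_smul (G.label_ne_zero E) ?_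
    rw [← hi₀]
    exact congrFun (congrArg Subtype.val hm) _
  · intro j m
    have hproj : (M.stalk (G.tgt E)).proj (2 + j) (a • m) = a • (M.stalk (G.tgt E)).proj j m :=
      GradedMod.proj_map _ _ (DistribSMul.toAddMonoidHom _ a) 2
        (fun i m hm => GradedMod.smul_mem _ (ι_mem_symDeg _) hm) j m
    have h1 : i m ∈ (M.gradedSections I).deg (j + 2) ↔ a • m ∈ (M.stalk (G.tgt E)).deg (j + 2) := by
      constructor
      · intro h
        have := h ⟨G.tgt E, hy⟩ trivial
        rw [← hi₀]
        exact this
      · intro h ⟨x, hxI⟩ _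
        change i₀ m ⟨x, hxI⟩ ∈ (M.stalk x).deg (j + 2)
        rcases hI x hxI with rfl | rfl
        · rw [hi₀']; exact zero_mem _
        · rw [hi₀]; exact h
    rw [h1, add_comm j 2]
    constructor
    · exact fun h => GradedMod.smul_mem _ (ι_mem_symDeg _) h
    -- Multiplication by the label is injective and commutes with projections up to the shift, so
    -- `m` is homogeneous as soon as its multiple is.
    · intro h
      rw [GradedMod.proj_same _ h] at hproj
      have h2 : m - (M.stalk (G.tgt E)).proj j m = 0 := by
        refine (hM.free _).eq_zero_of_ι_smul (G.label_ne_zero E) ?_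
        rw [smul_sub]
        exact sub_eq_zero.mpr hproj
      rw [sub_eq_zero.mp h2]
      exact GradedMod.proj_mem _ _ _
  · intro m
    constructor
    · intro h
      obtain ⟨d, hd⟩ := (hM.ker E (m.1 ⟨G.tgt E, hy⟩)).mp (by
        rw [← m.2 E hx hy]
        exact (congrArg _ h).trans (map_zero _))
      exact ⟨d, hext' _ _ ((hi₀' d).trans h.symm) ((hi₀ d).trans hd.symm)⟩
    · rintro ⟨d, rfl⟩
      exact hi₀' d

/-- If a projective sheaf is nonzero at the end of an edge, it is nonzero at its start. -/
theorem IsProjective.src_mem_supp (hM : M.IsProjective) (E : G.Edge) (h : G.tgt E ∈ M.supp) :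
    G.src E ∈ M.supp := by
  by_contra hx
  have hsub : Subsingleton (M.stalk (G.src E)) := not_nontrivial_iff_subsingleton.mp hx
  refine not_nontrivial_iff_subsingleton.mpr
    ((hM.free _).subsingleton_of_divisible (G.label_ne_zero E) fun m => ?_) h
  -- With zero stalk at the start, every section restricts to zero on `E`; so every element at the
  -- end is divisible by the label, impossible in a nonzero free module.
  obtain ⟨n, hn, rfl⟩ := hM.generated _ m
  refine (hM.ker E _).mp ?_
  rw [← hn E trivial trivial, Subsingleton.elim (n ⟨G.src E, trivial⟩) 0, map_zero]

/-- Multiplication by a vector that is not proportional to the label is injective on the module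
of an edge. -/
theorem IsProjective.eq_zero_of_ι_smul (hM : M.IsProjective) (E : G.Edge) {c : U}
    (hc : Nontrivial (M.stalk (G.tgt E)) → c ∉ Submodule.span 𝔽 {G.label E})
    {m : (M.edge E).mod} (hm : SymmetricAlgebra.ι 𝔽 U c • m = 0) : m = 0 := by
  obtain ⟨d, rfl⟩ := hM.surjective E m
  rcases subsingleton_or_nontrivial (M.stalk (G.tgt E)) with h | h
  · rw [Subsingleton.elim d 0, map_zero]
  · rw [← map_smul] at hm
    obtain ⟨d', hd'⟩ := (hM.ker E _).mp hm
    exact (hM.ker E _).mpr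
      ((hM.free _).exists_eq_ι_smul (G.label_ne_zero E) (hc h) hd')

end Sheaf

end GeneralSheaves

/-! ### The sheaf `ϑ_on M` and its projectivity -/

section ThetaOn

set_option linter.unusedSectionVars false

variable {ι N : Type u} {V : Type v} [Finite ι]
    [AddCommGroup V] [Module ℚ V] [AddCommGroup N] [Module ℚ N]
    {P : RootPairing ι ℚ V N} [P.IsRootSystem] [P.IsCrystallographic] [P.IsReduced]
    [P.IsIrreducible] {b : P.Base} {s : affineWeylGroup P}
    {𝔽 : Type f} [Field 𝔽] {h2 : (2 : 𝔽) ≠ 0}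

theorem AffineEdge.eq_of_src_tgt {E E' : AffineEdge b} (hx : E.src = E'.src)
    (hy : E.tgt = E'.tgt) : E = E' := by
  obtain ⟨x, y, γ, h1, h3, h4⟩ := E
  obtain ⟨x', y', γ', h1', h3', h4'⟩ := E'
  dsimp only at hx hy
  subst hx hy
  have h := mul_right_cancel (h3.symm.trans h3')
  rcases affineReflection_inj h with rfl | rfl
  · rfl
  · exact absurd h1' ((isPosAffine_neg b _).mp h1)

/-- The edge in the affine moment graph over a coset of `{1, s}`. -/
theorem exists_edge_over (hs : s ∈ simpleReflections b)
    (q : affineWeylGroup P ⧸ Subgroup.zpowers s) :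
    ∃ E : AffineEdge b, E.tgt = E.src * s ∧
      (E.src : affineWeylGroup P ⧸ Subgroup.zpowers s) = q := by
  obtain ⟨x, rfl⟩ := QuotientGroup.mk_surjective q
  rcases wordLength_lt_or_gt hs x with h | h
  · obtain ⟨E, rfl, h'⟩ := exists_edge_to_mul_simple hs h
    exact ⟨E, h', rfl⟩
  · obtain ⟨E, h3, h'⟩ := exists_edge_to_mul_simple hs h
    exact ⟨E, by rw [h', h3], by rw [h3, mk_mul_simple]⟩

theorem mem_fiber_iff (hs : s ∈ simpleReflections b) (E : AffineEdge b)
    (hE : E.tgt = E.src * s) (x : affineWeylGroup P) :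
    x ∈ fiber s (E.src : affineWeylGroup P ⧸ Subgroup.zpowers s) ↔ x = E.src ∨ x = E.tgt := by
  rw [hE]
  exact eq_comm.trans (mk_eq_iff b hs)

theorem AffineEdge.eq_of_mem_fiber (hs : s ∈ simpleReflections b)
    {E E' : AffineEdge b} (hE : E.tgt = E.src * s)
    (hx : E'.src ∈ fiber s (E.src : affineWeylGroup P ⧸ Subgroup.zpowers s))
    (hy : E'.tgt ∈ fiber s (E.src : affineWeylGroup P ⧸ Subgroup.zpowers s)) : E' = E := by
  have h' := E'.tgt_eq_of_mk_eq hs (hx.trans hy.symm)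
  rcases (mem_fiber_iff hs E hE _).mp hx with h | h
  · exact AffineEdge.eq_of_src_tgt h (by rw [h', h, hE])
  · exfalso
    have h1 := E.bruhatStep.2
    have h3 := E'.bruhatStep.2
    rw [h', h, hE, mul_simple_mul_simple hs] at h3
    rw [hE] at h1
    exact lt_asymm h1 h3

variable (𝔽) in
theorem exists_affineLabel_eq (hs : s ∈ simpleReflections b) (E : AffineEdge b)
    (h : (E.src : affineWeylGroup P ⧸ Subgroup.zpowers s) = E.tgt) :
    ∃ ε : 𝔽, affineLabel P 𝔽 E.root = ε • wallLabel hs 𝔽 E.src := by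
  rcases affineLabel_of_mk_eq hs 𝔽 E h with h | h
  · exact ⟨1, by rw [h, one_smul]⟩
  · exact ⟨-1, by rw [h, neg_one_smul]⟩

variable (𝔽) in
theorem exists_wallLabel_eq (hs : s ∈ simpleReflections b) {x y : affineWeylGroup P}
    (h : (x : affineWeylGroup P ⧸ Subgroup.zpowers s) = y) :
    ∃ ε : 𝔽, wallLabel hs 𝔽 x = ε • wallLabel hs 𝔽 y := by
  rcases (mk_eq_iff b hs).mp h with rfl | rfl
  · exact ⟨1, by rw [one_smul]⟩
  · exact ⟨-1, by rw [wallLabel_mul_simple]; module⟩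

namespace Sheaf

variable {M : Sheaf.{u, max f v, u, f, w} (affineMomentGraph b h2)}

theorem IsProjective.exists_section_fiber_edge (hM : M.IsProjective)
    (hs : s ∈ simpleReflections b) (E : AffineEdge b)
    (hE : E.tgt = E.src * s) (a : M.stalk E.src) (c : M.stalk E.tgt)
    (hac : (M.edge E).rhoSrc.toLin a = (M.edge E).rhoTgt.toLin c) :
    ∃ n ∈ M.sections Set.univ, n ⟨E.src, trivial⟩ = a ∧ n ⟨E.tgt, trivial⟩ = c := by
  obtain ⟨ε, hε⟩ := exists_affineLabel_eq 𝔽 hs E (by rw [hE, mk_mul_simple])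
  -- This function vanishes at `E.src`. Since the wall label changes sign at `E.tgt = E.src * s`, it
  -- takes the value `ε • wallLabel hs 𝔽 E.src` there, which is the label of `E`; the factor `1/2`
  -- cancels the doubling.
  refine hM.exists_section_pair (G := affineMomentGraph b h2) E
    (fun w => (ε / 2) • (wallLabel hs 𝔽 E.src - wallLabel hs 𝔽 w)) ?_ ?_ ?_ a c hac
  · intro E'
    obtain ⟨t, ht⟩ := wallLabel_tgt hs 𝔽 E'
    refine ⟨-(ε / 2 * t), ?_⟩
    change (ε / 2) • (wallLabel hs 𝔽 E.src - wallLabel hs 𝔽 E'.tgt) =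
      (ε / 2) • (wallLabel hs 𝔽 E.src - wallLabel hs 𝔽 E'.src) + _ • affineLabel P 𝔽 E'.root
    rw [ht]
    module
  · change (ε / 2) • (wallLabel hs 𝔽 E.src - wallLabel hs 𝔽 E.src) = 0
    rw [sub_self, smul_zero]
  · change (ε / 2) • (wallLabel hs 𝔽 E.src - wallLabel hs 𝔽 E.tgt) = affineLabel P 𝔽 E.root
    rw [hE, wallLabel_mul_simple, hε, sub_neg_eq_add, ← two_smul 𝔽, smul_smul,
      div_mul_cancel₀ _ h2]

theorem IsProjective.exists_global_of_onStalk (hM : M.IsProjective)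
    (hs : s ∈ simpleReflections b)
    (q : affineWeylGroup P ⧸ Subgroup.zpowers s) (m : M.onStalk hs q) :
    ∃ n ∈ M.sections Set.univ, ∀ x : fiber s q, n ⟨x.1, trivial⟩ = m.1 x := by
  obtain ⟨E, hE, rfl⟩ := exists_edge_over hs q
  have hx : E.src ∈ fiber s (E.src : affineWeylGroup P ⧸ Subgroup.zpowers s) := rfl
  have hy : E.tgt ∈ fiber s (E.src : affineWeylGroup P ⧸ Subgroup.zpowers s) :=
    (mem_fiber_iff hs E hE _).mpr (Or.inr rfl)
  obtain ⟨n, hn, h1, h3⟩ := hM.exists_section_fiber_edge hs E hE (m.1 ⟨E.src, hx⟩)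
    (m.1 ⟨E.tgt, hy⟩) (m.2 E hx hy)
  refine ⟨n, hn, fun ⟨x, hxq⟩ => ?_⟩
  rcases (mem_fiber_iff hs E hE x).mp hxq with rfl | rfl
  · exact h1
  · exact h3

theorem IsProjective.nontrivial_onStalk (hM : M.IsProjective) (hs : s ∈ simpleReflections b)
    (x : affineWeylGroup P) (hx : Nontrivial (M.stalk x)) :
    Nontrivial (M.onStalk hs (x : affineWeylGroup P ⧸ Subgroup.zpowers s)) := by
  by_contra hno
  have hsub := not_nontrivial_iff_subsingleton.mp hno
  refine not_subsingleton_iff_nontrivial.mpr hx (subsingleton_of_forall_eq 0 fun a => ?_)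
  obtain ⟨n, hn, rfl⟩ := hM.generated x a
  let m : M.sections (fiber s (x : affineWeylGroup P ⧸ Subgroup.zpowers s)) :=
    ⟨fun y => n ⟨y.1, trivial⟩, fun E _ _ => hn E trivial trivial⟩
  exact congrFun (congrArg Subtype.val (hsub.elim m (0 : M.sections _))) ⟨x, rfl⟩

theorem IsProjective.isFree_onStalk (hM : M.IsProjective)
    (hs : s ∈ simpleReflections b)
    (q : affineWeylGroup P ⧸ Subgroup.zpowers s) : (M.onStalk hs q).IsFree := by
  obtain ⟨E, hE, rfl⟩ := exists_edge_over hs q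
  exact hM.isFree_gradedSections (G := affineMomentGraph b h2) E (fiber s _)
    (finite_fiber hs _) rfl
    ((mem_fiber_iff hs E hE _).mpr (Or.inr rfl)) (fun x hx => (mem_fiber_iff hs E hE x).mp hx)
    (fun E' hx hy => AffineEdge.eq_of_mem_fiber hs hE hx hy)
    (hM.exists_section_fiber_edge hs E hE)

/-- Extend the element to a global section of `M`: its restriction to the coset at the other end has
the same image on the edges over `F`. No condition on labels is needed. -/
theorem IsProjective.onWellDefined (hM : M.IsProjective)
    (hs : s ∈ simpleReflections b) : M.OnWellDefined hs := by
  intro F m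
  obtain ⟨n, hn, hnm⟩ := hM.exists_global_of_onStalk hs F.src m
  refine ⟨⟨fun x => n ⟨x, trivial⟩, fun E _ _ => hn E trivial trivial⟩, ?_⟩
  funext E
  refine (hn E.1 trivial trivial).symm.trans ?_
  exact congrArg (M.edge E.1).rhoSrc.toLin (hnm ⟨E.1.src, E.2.1⟩)

variable {hs : s ∈ simpleReflections b} {h : M.OnWellDefined hs}

/-- A section of `M` over the preimage of a set of cosets, as a section of `ϑ_on M`. -/
def onSection (h : M.OnWellDefined hs) (J : Set (affineWeylGroup P ⧸ Subgroup.zpowers s))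
    (I : Set (affineWeylGroup P))
    (hI : ∀ x : affineWeylGroup P, (x : affineWeylGroup P ⧸ Subgroup.zpowers s) ∈ J → x ∈ I)
    (m : M.sections I) (q : J) : (M.thetaOn hs h).stalk q.1 :=
  (⟨fun x => m.1 ⟨x.1, hI x.1 (by rw [show _ = q.1 from x.2]; exact q.2)⟩,
    fun E _ _ => m.2 E _ _⟩ : M.sections (fiber s q.1))

theorem onSection_mem_sections (J : Set (affineWeylGroup P ⧸ Subgroup.zpowers s))
    (I : Set (affineWeylGroup P))
    (hI : ∀ x : affineWeylGroup P, (x : affineWeylGroup P ⧸ Subgroup.zpowers s) ∈ J → x ∈ I)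
    (m : M.sections I) : onSection h J I hI m ∈ (M.thetaOn hs h).sections J := by
  intro F hx hy
  refine Subtype.ext (funext fun E => ?_)
  exact m.2 E.1 _ _

/-- A section of `ϑ_on M` over a set of cosets, as a family over the preimage. -/
def ofOnSection (J : Set (affineWeylGroup P ⧸ Subgroup.zpowers s))
    (n : ∀ q : J, (M.thetaOn hs h).stalk q.1)
    (x : {x : affineWeylGroup P | (x : affineWeylGroup P ⧸ Subgroup.zpowers s) ∈ J}) :
    M.stalk x.1 :=
  (n ⟨x.1, x.2⟩).1 ⟨x.1, rfl⟩

/-- This removes the dependence on the representative, for a coset that is only propositionally the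
class of `x`. -/
theorem ofOnSection_apply {J : Set (affineWeylGroup P ⧸ Subgroup.zpowers s)}
    (n : ∀ q : J, (M.thetaOn hs h).stalk q.1) (x : affineWeylGroup P) (q : J)
    (hx : (x : affineWeylGroup P ⧸ Subgroup.zpowers s) = q.1) :
    ofOnSection J n ⟨x, by rw [Set.mem_ofPred_eq, hx]; exact q.2⟩ = (n q).1 ⟨x, hx⟩ := by
  obtain ⟨q, hq⟩ := q
  have hx' : (x : affineWeylGroup P ⧸ Subgroup.zpowers s) = q := hx
  subst hx'
  rfl

theorem ofOnSection_mem_sections (J : Set (affineWeylGroup P ⧸ Subgroup.zpowers s))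
    {n : ∀ q : J, (M.thetaOn hs h).stalk q.1} (hn : n ∈ (M.thetaOn hs h).sections J) :
    ofOnSection J n ∈ M.sections
      {x : affineWeylGroup P | (x : affineWeylGroup P ⧸ Subgroup.zpowers s) ∈ J} := by
  intro E hx hy
  by_cases hE : (E.src : affineWeylGroup P ⧸ Subgroup.zpowers s) = E.tgt
  · refine ((n ⟨_, hx⟩).2 E rfl hE.symm).trans ?_
    exact congrArg (M.edge E).rhoTgt.toLin (ofOnSection_apply n E.tgt ⟨_, hx⟩ hE.symm).symm
  · let F : QuotientEdge b s := ⟨E.src, E.tgt, E.root, hE, E, rfl, rfl, rfl⟩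
    exact congrFun (congrArg Subtype.val (hn F hx hy)) ⟨E, rfl, rfl, rfl⟩

theorem exists_mem_supp_of_nontrivial {q : affineWeylGroup P ⧸ Subgroup.zpowers s}
    (hq : Nontrivial (M.onStalk hs q)) :
    ∃ x ∈ M.supp, (show affineWeylGroup P from x : affineWeylGroup P ⧸ Subgroup.zpowers s) = q := by
  by_contra! hno
  refine not_subsingleton_iff_nontrivial.mpr hq ⟨fun m m' => Subtype.ext (funext fun x => ?_)⟩
  have : Subsingleton (M.stalk x.1) :=
    not_nontrivial_iff_subsingleton.mp fun hx => hno x.1 hx x.2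
  exact Subsingleton.elim _ _

theorem exists_edgesOver_tgt_eq (hs : s ∈ simpleReflections b) (F : QuotientEdge b s)
    (y : fiber s F.tgt) : ∃ E : EdgesOver F, E.1.tgt = y.1 := by
  obtain ⟨E, h1, h3, h4⟩ := F.exists_edge
  rcases (mk_eq_iff b hs).mp (h3.trans (show _ = F.tgt from y.2).symm) with h | h
  · exact ⟨⟨E, h1, h3, h4⟩, h.symm⟩
  · obtain ⟨E', h5, h6, h7⟩ := E.exists_shift hs (by rw [h1, h3]; exact F.ne)
    exact ⟨⟨E', by rw [h5, mk_mul_simple, h1], by rw [h6, mk_mul_simple, h3], by rw [h7, h4]⟩,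
      h6.trans h.symm⟩

/-- The label of every edge that does not lie over a vertex of the quotient graph, and that ends in
a coset on which `M` does not vanish, is not proportional to the label of the edge over
that coset. -/
def LabelsIndependent (hs : s ∈ simpleReflections b)
    (M : Sheaf.{u, max f v, u, f, w} (affineMomentGraph b h2)) : Prop :=
  ∀ E : AffineEdge b, (E.src : affineWeylGroup P ⧸ Subgroup.zpowers s) ≠ E.tgt →
    Nontrivial (M.onStalk hs (E.tgt : affineWeylGroup P ⧸ Subgroup.zpowers s)) →
    wallLabel hs 𝔽 E.tgt ∉ Submodule.span 𝔽 {affineLabel P 𝔽 E.root}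

/-- Each point of the target coset is the end of an edge over `F`, so both components of `m` are
divisible by the label. The quotients agree along the wall edge because they do so after
multiplication by that label, which acts injectively there. -/
theorem IsProjective.thetaOn_ker (hM : M.IsProjective) (hG : LabelsIndependent hs M)
    (F : QuotientEdge b s) (m : M.onStalk hs F.tgt) (hm : (M.onTgt hs F).toLin m = 0) :
    ∃ m' : M.onStalk hs F.tgt,
      m = SymmetricAlgebra.ι 𝔽 (LabelSpace P 𝔽) (affineLabel P 𝔽 F.root) • m' := by
  have hdiv : ∀ y : fiber s F.tgt, ∃ m' : M.stalk y.1,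
      m.1 y = SymmetricAlgebra.ι 𝔽 (LabelSpace P 𝔽) (affineLabel P 𝔽 F.root) • m' := by
    rintro ⟨y, hy⟩
    obtain ⟨E, hE⟩ := exists_edgesOver_tgt_eq hs F ⟨y, hy⟩
    dsimp only at hE
    subst hE
    obtain ⟨m', hm'⟩ := (hM.ker E.1 _).mp (congrFun hm E)
    have hl : (affineMomentGraph b h2).label E.1 = affineLabel P 𝔽 F.root :=
      congrArg (affineLabel P 𝔽) E.2.2.2
    exact ⟨m', hm'.trans (congrArg (fun a => SymmetricAlgebra.ι 𝔽 (LabelSpace P 𝔽) a • m') hl)⟩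
  choose m' hm' using hdiv
  refine ⟨⟨m', fun E hx hy => ?_⟩, Subtype.ext (funext hm')⟩
  rw [← sub_eq_zero]
  obtain ⟨E', h1, h3, h4⟩ := F.exists_edge
  refine hM.eq_zero_of_ι_smul E (c := affineLabel P 𝔽 F.root) (fun hnt => ?_) ?_
  · have h5 := hM.nontrivial_onStalk hs E.tgt hnt
    rw [show (E.tgt : affineWeylGroup P ⧸ Subgroup.zpowers s) = E'.tgt from
      (show _ = F.tgt from hy).trans h3.symm] at h5
    have h6 := notMem_span_singleton_comm (affineLabel_ne_zero h2 _)
      (hG E' (by rw [h1, h3]; exact F.ne) h5)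
    rw [h4] at h6
    -- The independence is known for the wall label at `E'.tgt`; the label of the wall edge `E` is a
    -- scalar multiple of it, since both belong to the same coset.
    refine fun h7 => h6 (Submodule.span_le.mpr ?_ h7)
    rw [Set.singleton_subset_iff]
    obtain ⟨ε, hε⟩ := exists_affineLabel_eq 𝔽 hs E
      ((show _ = F.tgt from hx).trans (show _ = F.tgt from hy).symm)
    obtain ⟨ε', hε'⟩ := exists_wallLabel_eq 𝔽 hs (x := E.src) (y := E'.tgt)
      ((show _ = F.tgt from hx).trans h3.symm)
    change affineLabel P 𝔽 E.root ∈ _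
    rw [hε, hε']
    exact Submodule.smul_mem _ _ (Submodule.smul_mem _ _ (Submodule.mem_span_singleton_self _))
  · rw [smul_sub, ← map_smul, ← map_smul, sub_eq_zero]
    exact (congrArg _ (hm' _)).symm.trans ((m.2 E hx hy).trans (congrArg _ (hm' _)))

theorem IsProjective.thetaOn_isProjective (hM : M.IsProjective) (hG : LabelsIndependent hs M) :
    (M.thetaOn hs h).IsProjective where
  finite_supp := by
    refine (hM.finite_supp.image fun x : affineWeylGroup P =>
      (x : affineWeylGroup P ⧸ Subgroup.zpowers s)).subset fun q hq => ?_
    obtain ⟨x, hx, hxq⟩ := exists_mem_supp_of_nontrivial (hs := hs) hq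
    exact ⟨x, hx, hxq⟩
  free q := hM.isFree_onStalk hs q
  surjective F := fun ⟨_, m, hm⟩ => ⟨m, Subtype.ext hm⟩
  ker F m := by
    constructor
    · intro hm
      exact hM.thetaOn_ker hG F m (congrArg Subtype.val hm)
    · rintro ⟨m', hm'⟩
      exact (congrArg _ hm').trans (rhoTgt_ι_label_smul (M.thetaOn hs h) F m')
  generated q a := by
    obtain ⟨n, hn, hna⟩ := hM.exists_global_of_onStalk hs q a
    refine ⟨onSection h Set.univ Set.univ (fun _ _ => trivial) ⟨n, hn⟩,
      onSection_mem_sections _ _ _ _, Subtype.ext (funext hna)⟩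
  flabby I' I hI hI' hIup m' hm' := by
    -- Preimages of open sets of cosets are open, so flabbiness of `M` applies to the section over
    -- the preimage.
    obtain ⟨n, hn, hnm⟩ := hM.flabby
      {x : affineWeylGroup P | (x : affineWeylGroup P ⧸ Subgroup.zpowers s) ∈ I'}
      {x : affineWeylGroup P | (x : affineWeylGroup P ⧸ Subgroup.zpowers s) ∈ I}
      (fun x hx => hI hx) (fun x y hxy hx => hI' ⟨x, y, rfl, rfl, hxy⟩ hx)
      (fun x y hxy hx => hIup ⟨x, y, rfl, rfl, hxy⟩ hx) _ (ofOnSection_mem_sections I' hm')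
    refine ⟨onSection h I _ (fun x hx => hx) ⟨n, hn⟩, onSection_mem_sections _ _ _ _,
      fun q => Subtype.ext (funext fun x => ?_)⟩
    exact (hnm ⟨x.1, _⟩).trans (ofOnSection_apply m' x.1 q x.2)

end Sheaf

end ThetaOn

/-! ### Open sets of cosets, and compatibility along the edges of `ϑ_out Q` -/

section ThetaOut

set_option linter.unusedSectionVars false

variable {ι N : Type u} {V : Type v} [Finite ι]
    [AddCommGroup V] [Module ℚ V] [AddCommGroup N] [Module ℚ N]
    {P : RootPairing ι ℚ V N} [P.IsRootSystem] [P.IsCrystallographic] [P.IsReduced]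
    [P.IsIrreducible] {b : P.Base} {s : affineWeylGroup P} {hs : s ∈ simpleReflections b}
    {𝔽 : Type f} [Field 𝔽] {h2 : (2 : 𝔽) ≠ 0}

theorem eq_zero_of_add_self {A U : Type*} [AddCommGroup U] [Module 𝔽 U] [AddCommGroup A]
    [Module (SymmetricAlgebra 𝔽 U) A] (h2 : (2 : 𝔽) ≠ 0) {x : A} (h : x + x = 0) : x = 0 := by
  have : NeZero (2 : 𝔽) := ⟨h2⟩
  have h1 : algebraMap 𝔽 (SymmetricAlgebra 𝔽 U) (1 / 2) • (x + x) = x := by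
    rw [smul_add, ← add_smul, ← map_add, add_halves, map_one, one_smul]
  rw [← h1, h, smul_zero]

theorem exists_edgesOver_src_eq (hs : s ∈ simpleReflections b) (F : QuotientEdge b s)
    (x : affineWeylGroup P) (hx : (x : affineWeylGroup P ⧸ Subgroup.zpowers s) = F.src) :
    ∃ E : EdgesOver F, E.1.src = x := by
  obtain ⟨E, h1, h3, h4⟩ := F.exists_edge
  rcases (mk_eq_iff b hs).mp (h1.trans hx.symm) with h | h
  · exact ⟨⟨E, h1, h3, h4⟩, h.symm⟩
  · obtain ⟨E', h5, h6, h7⟩ := E.exists_shift hs (by rw [h1, h3]; exact F.ne)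
    exact ⟨⟨E', by rw [h5, mk_mul_simple, h1], by rw [h6, mk_mul_simple, h3], by rw [h7, h4]⟩,
      h5.trans h.symm⟩

/-- The cosets contained in an open set form an open set. -/
theorem isUpperSet_cosets_subset (h2 : (2 : 𝔽) ≠ 0) (hs : s ∈ simpleReflections b)
    {I : Set (affineMomentGraph b h2).Vertex} (hI : IsUpperSet I) :
    IsUpperSet ({q | ∀ x : affineWeylGroup P, (x : affineWeylGroup P ⧸ Subgroup.zpowers s) = q →
      x ∈ I} : Set (quotientMomentGraph b h2 hs).Vertex) := by
  rintro _ _ ⟨u, v, rfl, rfl, huv⟩ hu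
  -- Both points of the coset are carried along the chain: each step either stays in the coset or is
  -- accompanied by its shift.
  have key : v ∈ I ∧ v * s ∈ I := by
    induction huv with
    | refl => exact ⟨hu u rfl, hu (u * s) (mk_mul_simple s u)⟩
    | tail _ h ih =>
      refine ⟨hI (show (bruhatOrder (simpleReflections b)).le _ _ from .single h) ih.1, ?_⟩
      rcases bruhatStep_shift b hs h with rfl | h'
      · rw [mul_simple_mul_simple hs]
        exact ih.1
      · exact hI (show (bruhatOrder (simpleReflections b)).le _ _ from .single h') ih.2
  intro y hy
  rcases (mk_eq_iff b hs).mp hy.symm with rfl | rfl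
  · exact key.1
  · exact key.2

/-- The cosets meeting an open set form an open set. -/
theorem isUpperSet_cosets_meeting (h2 : (2 : 𝔽) ≠ 0) (hs : s ∈ simpleReflections b)
    {I : Set (affineMomentGraph b h2).Vertex} (hI : IsUpperSet I) :
    IsUpperSet ({q | ∃ x : affineWeylGroup P, (x : affineWeylGroup P ⧸ Subgroup.zpowers s) = q ∧
      x ∈ I} : Set (quotientMomentGraph b h2 hs).Vertex) := by
  rintro _ _ ⟨u, v, rfl, rfl, huv⟩ ⟨x, hx, hxI⟩
  have key : v ∈ I ∨ v * s ∈ I := by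
    induction huv with
    | refl =>
      rcases (mk_eq_iff b hs).mp hx.symm with rfl | rfl
      · exact Or.inl hxI
      · exact Or.inr hxI
    | tail _ h ih =>
      rcases ih with ih | ih
      · exact Or.inl (hI (show (bruhatOrder (simpleReflections b)).le _ _ from .single h) ih)
      · rcases bruhatStep_shift b hs h with rfl | h'
        · exact Or.inl ih
        · exact Or.inr (hI (show (bruhatOrder (simpleReflections b)).le _ _ from .single h') ih)
  rcases key with h | h
  · exact ⟨v, rfl, h⟩
  · exact ⟨v * s, mk_mul_simple s v, h⟩

namespace Sheaf

variable {Q : Sheaf.{u, max f v, u, f, w} (quotientMomentGraph b h2 hs)}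

/-- The identification of the stalks at equal cosets. -/
def stalkCast (Q : Sheaf.{u, max f v, u, f, w} (quotientMomentGraph b h2 hs)) :
    ∀ {p q : affineWeylGroup P ⧸ Subgroup.zpowers s}, p = q →
      (Q.stalk p →ₗ[SymmetricAlgebra 𝔽 (LabelSpace P 𝔽)] Q.stalk q)
  | _, _, rfl => LinearMap.id

theorem stalkCast_apply {J : Set (affineWeylGroup P ⧸ Subgroup.zpowers s)}
    (n : ∀ q : J, Q.stalk q.1) {p q : affineWeylGroup P ⧸ Subgroup.zpowers s} (h : p = q)
    (hp : p ∈ J) (hq : q ∈ J) : Q.stalkCast h (n ⟨p, hp⟩) = n ⟨q, hq⟩ := by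
  subst h
  rfl

theorem loopDatum_compat_iff (a : LabelSpace P 𝔽)
    {p q : affineWeylGroup P ⧸ Subgroup.zpowers s} (h : p = q) (m : Q.stalk p) (m' : Q.stalk q) :
    (Q.loopDatum a h).rhoSrc.toLin m = (Q.loopDatum a h).rhoTgt.toLin m' ↔
      ∃ k : Q.stalk p, Q.stalkCast h.symm m' = m + SymmetricAlgebra.ι 𝔽 _ a • k := by
  subst h
  refine eq_comm.trans ((Submodule.Quotient.eq _).trans ?_)
  constructor
  · rintro ⟨k, hk⟩
    exact ⟨k, eq_add_of_sub_eq' hk.symm⟩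
  · rintro ⟨k, hk⟩
    exact ⟨k, (sub_eq_of_eq_add' hk).symm⟩

theorem loopDatum_rhoTgt_surjective (a : LabelSpace P 𝔽)
    {p q : affineWeylGroup P ⧸ Subgroup.zpowers s} (h : p = q) :
    Function.Surjective (Q.loopDatum a h).rhoTgt.toLin := by
  subst h
  exact Submodule.mkQ_surjective _

theorem loopDatum_rhoTgt_eq_zero_iff (a : LabelSpace P 𝔽)
    {p q : affineWeylGroup P ⧸ Subgroup.zpowers s} (h : p = q) (m : Q.stalk q) :
    (Q.loopDatum a h).rhoTgt.toLin m = 0 ↔ ∃ k : Q.stalk q, m = SymmetricAlgebra.ι 𝔽 _ a • k := by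
  subst h
  refine (Submodule.Quotient.mk_eq_zero _).trans ⟨?_, ?_⟩
  · rintro ⟨k, hk⟩
    exact ⟨k, hk.symm⟩
  · rintro ⟨k, hk⟩
    exact ⟨k, hk.symm⟩

/-- The edge of the quotient graph below an edge of the affine moment graph. -/
def _root_.MomentGraphs.AffineEdge.toQuotient (E : AffineEdge b)
    (h : (E.src : affineWeylGroup P ⧸ Subgroup.zpowers s) ≠ E.tgt) : QuotientEdge b s :=
  ⟨E.src, E.tgt, E.root, h, E, rfl, rfl, rfl⟩

theorem thetaOut_edge_of_eq (E : AffineEdge b)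
    (h : (E.src : affineWeylGroup P ⧸ Subgroup.zpowers s) = E.tgt) :
    Q.thetaOut.edge E = Q.loopDatum (affineLabel P 𝔽 E.root) h := dif_pos h

theorem thetaOut_edge_of_ne (E : AffineEdge b)
    (h : (E.src : affineWeylGroup P ⧸ Subgroup.zpowers s) ≠ E.tgt) :
    Q.thetaOut.edge E = Q.edge (E.toQuotient h) := dif_neg h

theorem thetaOut_compat_iff_of_eq (E : AffineEdge b)
    (h : (E.src : affineWeylGroup P ⧸ Subgroup.zpowers s) = E.tgt)
    (m : Q.stalk (E.src : affineWeylGroup P ⧸ Subgroup.zpowers s))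
    (m' : Q.stalk (E.tgt : affineWeylGroup P ⧸ Subgroup.zpowers s)) :
    (Q.thetaOut.edge E).rhoSrc.toLin m = (Q.thetaOut.edge E).rhoTgt.toLin m' ↔
      ∃ k : Q.stalk (E.src : affineWeylGroup P ⧸ Subgroup.zpowers s),
        Q.stalkCast h.symm m' = m + SymmetricAlgebra.ι 𝔽 _ (affineLabel P 𝔽 E.root) • k := by
  rw [thetaOut_edge_of_eq E h]
  exact loopDatum_compat_iff _ h m m'

/-- The casts allow the conditions on both lifts of `F` to be compared in the single module attached
to `F`. -/
theorem thetaOut_compat_iff_over (F : QuotientEdge b s) (E : EdgesOver F)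
    (m : Q.stalk (E.1.src : affineWeylGroup P ⧸ Subgroup.zpowers s))
    (m' : Q.stalk (E.1.tgt : affineWeylGroup P ⧸ Subgroup.zpowers s)) :
    (Q.thetaOut.edge E.1).rhoSrc.toLin m = (Q.thetaOut.edge E.1).rhoTgt.toLin m' ↔
      (Q.edge F).rhoSrc.toLin (Q.stalkCast E.2.1 m) =
        (Q.edge F).rhoTgt.toLin (Q.stalkCast E.2.2.1 m') := by
  obtain ⟨x, y, r, hne, hex⟩ := F
  obtain ⟨E, h1, h3, h4⟩ := E
  dsimp only at h1 h3 h4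
  subst h1 h3 h4
  rw [thetaOut_edge_of_ne E hne]
  rfl

/-- A section of `Q` pulls back to a family constant on cosets; along wall edges the difference to
be divided by the label is zero. -/
theorem comp_mk_mem_sections {J : Set (affineWeylGroup P ⧸ Subgroup.zpowers s)}
    {n : ∀ q : J, Q.stalk q.1} (hn : n ∈ Q.sections J) {I : Set (affineWeylGroup P)}
    (hI : ∀ x : affineWeylGroup P, x ∈ I → (x : affineWeylGroup P ⧸ Subgroup.zpowers s) ∈ J) :
    (fun x : I => n ⟨(x.1 : affineWeylGroup P ⧸ Subgroup.zpowers s), hI x.1 x.2⟩ :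
      ∀ x : I, Q.thetaOut.stalk x.1) ∈ Q.thetaOut.sections I := by
  intro E hx hy
  by_cases h : (E.src : affineWeylGroup P ⧸ Subgroup.zpowers s) = E.tgt
  · refine (thetaOut_compat_iff_of_eq E h _ _).mpr ⟨0, ?_⟩
    rw [smul_zero]
    exact (stalkCast_apply n h.symm _ _).trans (add_zero _).symm
  · exact (thetaOut_compat_iff_over (E.toQuotient h) ⟨E, rfl, rfl, rfl⟩ _ _).mpr
      (hn (E.toQuotient h) (hI _ hx) (hI _ hy))

end Sheaf

end ThetaOut

/-! ### Projectivity of `ϑ_out Q`, the use of the GKM-property, and the theorem -/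

section ThetaOutProjective

set_option linter.unusedSectionVars false

variable {ι N : Type u} {V : Type v} [Finite ι]
    [AddCommGroup V] [Module ℚ V] [AddCommGroup N] [Module ℚ N]
    {P : RootPairing ι ℚ V N} [P.IsRootSystem] [P.IsCrystallographic] [P.IsReduced]
    [P.IsIrreducible] {b : P.Base} {s : affineWeylGroup P} {hs : s ∈ simpleReflections b}
    {𝔽 : Type f} [Field 𝔽] {h2 : (2 : 𝔽) ≠ 0}

namespace Sheaf

variable {Q : Sheaf.{u, max f v, u, f, w} (quotientMomentGraph b h2 hs)}

/-- Over a coset contained in `I`, a section of `ϑ_out Q` has the form `x ↦ p + c x • k`, where `c`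
is the label of the wall. -/
theorem exists_decomposition {I : Set (affineWeylGroup P)} {m : ∀ x : I, Q.thetaOut.stalk x.1}
    (hm : m ∈ Q.thetaOut.sections I) (q : affineWeylGroup P ⧸ Subgroup.zpowers s)
    (hq : ∀ x : affineWeylGroup P, (x : affineWeylGroup P ⧸ Subgroup.zpowers s) = q → x ∈ I) :
    ∃ p k : Q.stalk q, ∀ (x : affineWeylGroup P)
      (hx : (x : affineWeylGroup P ⧸ Subgroup.zpowers s) = q) (hxI : x ∈ I),
      Q.stalkCast hx (m ⟨x, hxI⟩) = p + SymmetricAlgebra.ι 𝔽 _ (wallLabel hs 𝔽 x) • k := by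
  have : NeZero (2 : 𝔽) := ⟨h2⟩
  obtain ⟨E, hE, rfl⟩ := exists_edge_over hs q
  have hst : (E.src : affineWeylGroup P ⧸ Subgroup.zpowers s) = E.tgt := by
    rw [hE, mk_mul_simple]
  obtain ⟨ε, hε⟩ := exists_affineLabel_eq 𝔽 hs E hst
  have hsI : E.src ∈ I := hq _ rfl
  have htI : E.tgt ∈ I := hq _ hst.symm
  obtain ⟨k, hk⟩ := (thetaOut_compat_iff_of_eq E hst (m ⟨E.src, hsI⟩) (m ⟨E.tgt, htI⟩)).mp
    (hm E hsI htI)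
  let c := SymmetricAlgebra.ι 𝔽 (LabelSpace P 𝔽) (wallLabel hs 𝔽 E.src)
  -- The value at the end of the wall edge is `a + ε c k = a - 2 t c k`. Taking `p = a - t c k`, the
  -- average of the two values, makes them `p + c (t k)` and `p - c (t k)`.
  let t := algebraMap 𝔽 (SymmetricAlgebra 𝔽 (LabelSpace P 𝔽)) (-(ε / 2))
  have hck : SymmetricAlgebra.ι 𝔽 _ (affineLabel P 𝔽 E.root) • k =
      -(c • (t • k) + c • (t • k)) := by
    have htt : t + t = -algebraMap 𝔽 (SymmetricAlgebra 𝔽 (LabelSpace P 𝔽)) ε := by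
      rw [← map_add, ← map_neg]
      congr 1
      rw [← neg_add, add_halves]
    rw [hε, map_smul, Algebra.smul_def, ← smul_add, ← add_smul, htt, neg_smul, smul_neg, neg_neg,
      mul_smul, smul_comm]
  let a : Q.stalk (E.src : affineWeylGroup P ⧸ Subgroup.zpowers s) := m ⟨E.src, hsI⟩
  refine ⟨a - c • (t • k), t • k, fun x hx hxI => ?_⟩
  rcases (mem_fiber_iff hs E hE x).mp hx with rfl | rfl
  · exact (sub_add_cancel a (c • (t • k))).symm
  · have hwt : wallLabel hs 𝔽 E.tgt = -wallLabel hs 𝔽 E.src := by rw [hE, wallLabel_mul_simple]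
    rw [hwt, map_neg, neg_smul]
    refine (hk.trans (congrArg (a + ·) hck)).trans ?_
    abel

/-- The two lifts of an edge `F` give `A + cB = 0` and `A - cB = 0` for the defects `A` of `p` and
`B` of `k`. Adding and dividing by `2` yields `A = 0`; then `cB = 0`, and `c` acts injectively on
the module of `F`. -/
theorem IsProjective.decomposition_mem_sections (hQ : Q.IsProjective)
    (hG : ∀ (F : QuotientEdge b s) (E : EdgesOver F), Nontrivial (Q.stalk F.tgt) →
      wallLabel hs 𝔽 E.1.tgt ∉ Submodule.span 𝔽 {affineLabel P 𝔽 F.root})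
    {I : Set (affineWeylGroup P)} {m : ∀ x : I, Q.thetaOut.stalk x.1}
    (hm : m ∈ Q.thetaOut.sections I) {J : Set (affineWeylGroup P ⧸ Subgroup.zpowers s)}
    (hJ : ∀ x : affineWeylGroup P, (x : affineWeylGroup P ⧸ Subgroup.zpowers s) ∈ J → x ∈ I)
    (p k : ∀ q : J, Q.stalk q.1)
    (hpk : ∀ (q : J) (x : affineWeylGroup P)
      (hx : (x : affineWeylGroup P ⧸ Subgroup.zpowers s) = q.1) (hxI : x ∈ I),
      Q.stalkCast hx (m ⟨x, hxI⟩) = p q + SymmetricAlgebra.ι 𝔽 _ (wallLabel hs 𝔽 x) • k q) :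
    p ∈ Q.sections J ∧ k ∈ Q.sections J := by
  suffices h : ∀ (F : QuotientEdge b s) (hx : F.src ∈ J) (hy : F.tgt ∈ J),
      (Q.edge F).rhoSrc.toLin (p ⟨F.src, hx⟩) = (Q.edge F).rhoTgt.toLin (p ⟨F.tgt, hy⟩) ∧
      (Q.edge F).rhoSrc.toLin (k ⟨F.src, hx⟩) = (Q.edge F).rhoTgt.toLin (k ⟨F.tgt, hy⟩) from
    ⟨fun F hx hy => (h F hx hy).1, fun F hx hy => (h F hx hy).2⟩
  intro F hx hy
  have key : ∀ E : EdgesOver F,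
      ((Q.edge F).rhoSrc.toLin (p ⟨F.src, hx⟩) - (Q.edge F).rhoTgt.toLin (p ⟨F.tgt, hy⟩)) +
      SymmetricAlgebra.ι 𝔽 _ (wallLabel hs 𝔽 E.1.tgt) •
        ((Q.edge F).rhoSrc.toLin (k ⟨F.src, hx⟩) - (Q.edge F).rhoTgt.toLin (k ⟨F.tgt, hy⟩)) =
        0 := by
    intro E
    have hxI : E.1.src ∈ I := hJ E.1.src (by rw [E.2.1]; exact hx)
    have hyI : E.1.tgt ∈ I := hJ E.1.tgt (by rw [E.2.2.1]; exact hy)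
    have h1 := (thetaOut_compat_iff_over F E _ _).mp (hm E.1 hxI hyI)
    have e1 := hpk ⟨F.src, hx⟩ E.1.src E.2.1 hxI
    have e2 := hpk ⟨F.tgt, hy⟩ E.1.tgt E.2.2.1 hyI
    have h3 := ((congrArg (Q.edge F).rhoSrc.toLin e1).symm.trans h1).trans
      (congrArg (Q.edge F).rhoTgt.toLin e2)
    obtain ⟨t, ht⟩ := wallLabel_tgt hs 𝔽 E.1
    rw [E.2.2.2] at ht
    exact EdgeDatum.compat_twisted (Q.edge F) ht _ _ _ _ h3
  obtain ⟨E, h1, h3, h4⟩ := F.exists_edge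
  obtain ⟨E', h5, h6, h7⟩ := E.exists_shift hs (by rw [h1, h3]; exact F.ne)
  have k1 := key ⟨E, h1, h3, h4⟩
  have k2 := key ⟨E', by rw [h5, mk_mul_simple, h1], by rw [h6, mk_mul_simple, h3], by rw [h7, h4]⟩
  dsimp only at k1 k2
  rw [h6, wallLabel_mul_simple, map_neg, neg_smul] at k2
  set A := (Q.edge F).rhoSrc.toLin (p ⟨F.src, hx⟩) - (Q.edge F).rhoTgt.toLin (p ⟨F.tgt, hy⟩)
    with hA
  set B := (Q.edge F).rhoSrc.toLin (k ⟨F.src, hx⟩) - (Q.edge F).rhoTgt.toLin (k ⟨F.tgt, hy⟩)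
    with hB
  have hAA : A + A = 0 := by
    rw [← add_zero (0 : (Q.edge F).mod)]
    nth_rewrite 1 [← k1]
    rw [← k2]
    abel
  have hA0 := eq_zero_of_add_self (𝔽 := 𝔽) (U := LabelSpace P 𝔽) h2 hAA
  rw [hA0, zero_add] at k1
  have hB0 : B = 0 := hQ.eq_zero_of_ι_smul F (hG F ⟨E, h1, h3, h4⟩) k1
  exact ⟨sub_eq_zero.mp hA0, sub_eq_zero.mp hB0⟩

/-- A section of `ϑ_out Q` over `I` that vanishes over all cosets contained in `I` comes from
a section of `Q`. -/
theorem exists_section_of_vanishing {I : Set (affineMomentGraph b h2).Vertex}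
    (hI : IsUpperSet I) {m : ∀ x : I, Q.thetaOut.stalk x.1} (hm : m ∈ Q.thetaOut.sections I)
    (hm0 : ∀ (x : affineWeylGroup P) (hx : x ∈ I),
      (∀ y : affineWeylGroup P, (y : affineWeylGroup P ⧸ Subgroup.zpowers s) = x → y ∈ I) →
      m ⟨x, hx⟩ = 0) :
    ∃ n ∈ Q.sections {q | ∃ x : affineWeylGroup P,
        (x : affineWeylGroup P ⧸ Subgroup.zpowers s) = q ∧ x ∈ I},
      ∀ (x : affineWeylGroup P) (hx : x ∈ I), m ⟨x, hx⟩ =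
        n ⟨(x : affineWeylGroup P ⧸ Subgroup.zpowers s), x, rfl, hx⟩ := by
  have hex : ∀ q : {q | ∃ x : affineWeylGroup P,
      (x : affineWeylGroup P ⧸ Subgroup.zpowers s) = q ∧ x ∈ I}, ∃ n : Q.stalk q.1,
      ∀ (x : affineWeylGroup P) (hx : (x : affineWeylGroup P ⧸ Subgroup.zpowers s) = q.1)
        (hxI : x ∈ I), Q.stalkCast hx (m ⟨x, hxI⟩) = n := by
    rintro ⟨_, x, rfl, hxI⟩
    refine ⟨m ⟨x, hxI⟩, fun y hy hyI => ?_⟩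
    -- Only a coset contained in `I` has two values to compare, and there both vanish.
    rcases (mk_eq_iff b hs).mp hy.symm with rfl | rfl
    · rfl
    · have hall : ∀ z : affineWeylGroup P,
          (z : affineWeylGroup P ⧸ Subgroup.zpowers s) = x → z ∈ I := by
        intro z hz
        rcases (mk_eq_iff b hs).mp hz.symm with rfl | rfl
        · exact hxI
        · exact hyI
      have e1 := hm0 x hxI hall
      have e2 := hm0 (x * s) hyI fun z hz => hall z (hz.trans hy)
      exact ((congrArg (Q.stalkCast hy) e2).trans (map_zero _)).trans e1.symm
  choose n hn using hex
  refine ⟨n, fun F hx hy => ?_, fun x hx => hn ⟨_, x, rfl, hx⟩ x rfl hx⟩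
  obtain ⟨x, hxF, hxI⟩ := hx
  obtain ⟨E, rfl⟩ := exists_edgesOver_src_eq hs F x hxF
  -- Starting the lift of `F` at a point of the open set `I` keeps its end in `I`, so compatibility
  -- of `m` there gives compatibility of `n` along `F`.
  have hyI : E.1.tgt ∈ I :=
    hI (((bruhatOrder (simpleReflections b)).lt_iff_le_not_ge _ _).mp E.1.lt).1 hxI
  have h1 := (thetaOut_compat_iff_over F E _ _).mp (hm E.1 hxI hyI)
  exact ((congrArg (Q.edge F).rhoSrc.toLin
    (hn ⟨F.src, _, hxF, hxI⟩ _ E.2.1 hxI)).symm.trans h1).trans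
    (congrArg (Q.edge F).rhoTgt.toLin (hn ⟨F.tgt, hy⟩ _ E.2.2.1 hyI))

/-- The extension is built in two stages because `I` may contain only one point of a coset. The
twisted form `p + c k` handles the full cosets, and the remainder is constant on cosets. -/
theorem IsProjective.thetaOut_flabby (hQ : Q.IsProjective)
    (hG : ∀ (F : QuotientEdge b s) (E : EdgesOver F), Nontrivial (Q.stalk F.tgt) →
      wallLabel hs 𝔽 E.1.tgt ∉ Submodule.span 𝔽 {affineLabel P 𝔽 F.root})
    {I : Set (affineMomentGraph b h2).Vertex}
    (hI : IsUpperSet I) {m : ∀ x : I, Q.thetaOut.stalk x.1} (hm : m ∈ Q.thetaOut.sections I) :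
    ∃ n ∈ Q.thetaOut.sections Set.univ, ∀ x : I, n ⟨x.1, trivial⟩ = m x := by
  -- the part of the section over the cosets contained in `I`
  obtain ⟨n₁, hn₁, hn₁m⟩ : ∃ n ∈ Q.thetaOut.sections Set.univ,
      ∀ (x : affineWeylGroup P) (hx : x ∈ I),
        (∀ y : affineWeylGroup P, (y : affineWeylGroup P ⧸ Subgroup.zpowers s) = x → y ∈ I) →
        n ⟨x, trivial⟩ = m ⟨x, hx⟩ := by
    let J : Set (affineWeylGroup P ⧸ Subgroup.zpowers s) :=
      {q | ∀ x : affineWeylGroup P, (x : affineWeylGroup P ⧸ Subgroup.zpowers s) = q → x ∈ I}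
    have hdec := fun q : J => exists_decomposition hm q.1 q.2
    choose p k hpk using hdec
    obtain ⟨hp, hk⟩ := hQ.decomposition_mem_sections hG hm (J := J) (fun x hx => hx x rfl) p k hpk
    have hJ := isUpperSet_cosets_subset h2 hs hI
    obtain ⟨p', hp', hpp'⟩ := hQ.flabby J Set.univ (Set.subset_univ _) hJ isUpperSet_univ p hp
    obtain ⟨k', hk', hkk'⟩ := hQ.flabby J Set.univ (Set.subset_univ _) hJ isUpperSet_univ k hk
    refine ⟨_, add_mem (comp_mk_mem_sections hp' (I := Set.univ) fun _ _ => trivial)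
      (ι_smul_mem_sections (G := affineMomentGraph b h2) (wallLabel hs 𝔽) (wallLabel_tgt hs 𝔽)
        (comp_mk_mem_sections hk' (I := Set.univ) fun _ _ => trivial)), fun x hx hall => ?_⟩
    refine ((hpk ⟨_, hall⟩ x rfl hx).trans (congrArg₂
      (fun a c => a + SymmetricAlgebra.ι 𝔽 (LabelSpace P 𝔽) (wallLabel hs 𝔽 x) • c)
      (hpp' ⟨_, hall⟩).symm (hkk' ⟨_, hall⟩).symm)).symm
  -- After subtracting `n₁` the section vanishes over the full cosets, so it descends to the cosets
  -- meeting `I`, which again form an open set.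
  have hrest : (fun x : I => n₁ ⟨x.1, trivial⟩) ∈ Q.thetaOut.sections I :=
    fun E _ _ => hn₁ E trivial trivial
  obtain ⟨n, hn, hnm⟩ := exists_section_of_vanishing hI (sub_mem hm hrest)
    (fun x hx hall => sub_eq_zero.mpr (hn₁m x hx hall).symm)
  obtain ⟨n', hn', hnn'⟩ := hQ.flabby _ Set.univ (Set.subset_univ _)
    (isUpperSet_cosets_meeting h2 hs hI) isUpperSet_univ n hn
  refine ⟨_, add_mem hn₁ (comp_mk_mem_sections hn' (I := Set.univ) fun _ _ => trivial),
    fun x => ?_⟩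
  have e := (hnm x.1 x.2).trans (hnn' ⟨_, x.1, rfl, x.2⟩).symm
  exact (congrArg (n₁ ⟨x.1, trivial⟩ + ·) e.symm).trans (add_sub_cancel _ _)

theorem IsProjective.thetaOut_isProjective (hQ : Q.IsProjective)
    (hG : ∀ (F : QuotientEdge b s) (E : EdgesOver F), Nontrivial (Q.stalk F.tgt) →
      wallLabel hs 𝔽 E.1.tgt ∉ Submodule.span 𝔽 {affineLabel P 𝔽 F.root}) :
    Q.thetaOut.IsProjective where
  finite_supp := by
    refine Set.Finite.preimage' (f := fun x : affineWeylGroup P =>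
      (x : affineWeylGroup P ⧸ Subgroup.zpowers s)) hQ.finite_supp fun q _ => ?_
    exact @Set.toFinite _ _ (finite_fiber hs q)
  free x := hQ.free _
  surjective E := by
    by_cases h : (E.src : affineWeylGroup P ⧸ Subgroup.zpowers s) = E.tgt
    · rw [thetaOut_edge_of_eq E h]
      exact loopDatum_rhoTgt_surjective _ h
    · rw [thetaOut_edge_of_ne E h]
      exact hQ.surjective (E.toQuotient h)
  ker E m := by
    by_cases h : (E.src : affineWeylGroup P ⧸ Subgroup.zpowers s) = E.tgt
    · rw [thetaOut_edge_of_eq E h]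
      exact loopDatum_rhoTgt_eq_zero_iff _ h m
    · rw [thetaOut_edge_of_ne E h]
      exact hQ.ker (E.toQuotient h) m
  generated x a := by
    obtain ⟨n, hn, hna⟩ := hQ.generated _ a
    exact ⟨_, comp_mk_mem_sections hn (I := Set.univ) fun _ _ => trivial, hna⟩
  flabby I' I hI hI' _ m' hm' := by
    obtain ⟨n, hn, hnm⟩ := hQ.thetaOut_flabby hG hI' hm'
    exact ⟨fun x => n ⟨x.1, trivial⟩, fun E _ _ => hn E trivial trivial, fun x => hnm x⟩

/-- Both `E` and the wall edge over the coset of `E.tgt` contain `E.tgt`, so GKM applies once all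
their vertices are known to lie in `T`, the union of the cosets meeting the support. -/
theorem IsProjective.labelsIndependent
    {M : Sheaf.{u, max f v, u, f, w} (affineMomentGraph b h2)} (hM : M.IsProjective)
    (hs : s ∈ simpleReflections b)
    (hGKM : ((affineMomentGraph b h2).full
      (M.supp ∪ (fun x : affineWeylGroup P => x * s) '' M.supp)).GKM) :
    LabelsIndependent hs M := by
  intro E hE hnt
  let T : Set (affineWeylGroup P) := M.supp ∪ (fun x : affineWeylGroup P => x * s) '' M.supp
  have hT : ∀ x y : affineWeylGroup P, x ∈ M.supp →
      (x : affineWeylGroup P ⧸ Subgroup.zpowers s) = y → y ∈ T := by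
    intro x y hx hxy
    rcases (mk_eq_iff b hs).mp hxy with rfl | rfl
    · exact Or.inl hx
    · exact Or.inr ⟨x, hx, rfl⟩
  obtain ⟨y, hy, hyE⟩ := exists_mem_supp_of_nontrivial hnt
  obtain ⟨⟨E', h1, h3, h4⟩, h5⟩ := exists_edgesOver_tgt_eq hs (E.toQuotient hE) ⟨y, hyE⟩
  -- The support is known only at some point `y` of the target coset. The lift `E'` ending at `y`
  -- has its start in the support, and `E.src` is in the same coset as that start.
  have hx : E'.src ∈ M.supp := hM.src_mem_supp E' (by
    change E'.tgt ∈ M.supp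
    dsimp only at h5
    rw [h5]
    exact hy)
  obtain ⟨E₀, h6, h7⟩ := exists_edge_over hs (E.tgt : affineWeylGroup P ⧸ Subgroup.zpowers s)
  have hst : (E₀.src : affineWeylGroup P ⧸ Subgroup.zpowers s) = E₀.tgt := by
    rw [h6, mk_mul_simple]
  let F : ((affineMomentGraph b h2).full T).Edge :=
    ⟨E, hT _ _ hx h1, hT _ _ hy hyE⟩
  let F₀ : ((affineMomentGraph b h2).full T).Edge :=
    ⟨E₀, hT _ _ hy (hyE.trans h7.symm), hT _ _ hy (hyE.trans (h7.symm.trans hst))⟩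
  have hne : F ≠ F₀ := by
    intro h
    have : E = E₀ := congrArg Subtype.val h
    exact hE (this ▸ hst)
  have key := hGKM F F₀ ⟨E.tgt, hT _ _ hy hyE⟩ hne (Or.inr rfl) (by
    rcases (mem_fiber_iff hs E₀ h6 E.tgt).mp h7.symm with h | h
    · exact Or.inl (Subtype.ext h)
    · exact Or.inr (Subtype.ext h))
  change affineLabel P 𝔽 E₀.root ∉ Submodule.span 𝔽 {affineLabel P 𝔽 E.root} at key
  obtain ⟨ε, hε⟩ := exists_affineLabel_eq 𝔽 hs E₀ hst
  obtain ⟨ε', hε'⟩ := exists_wallLabel_eq 𝔽 hs h7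
  intro h
  exact key (hε ▸ hε' ▸ Submodule.smul_mem _ _ (Submodule.smul_mem _ _ h))

end Sheaf

end ThetaOutProjective

end MomentGraphs

theorem theorem8 {ι N : Type u} {V : Type v} {𝔽 : Type f} [Finite ι]
    [AddCommGroup V] [Module ℚ V] [AddCommGroup N] [Module ℚ N]
    (P : RootPairing ι ℚ V N) [P.IsRootSystem] [P.IsCrystallographic] [P.IsReduced]
    [P.IsIrreducible] (b : P.Base) [Field 𝔽] (h2 : (2 : 𝔽) ≠ 0)
    (s : MomentGraphs.affineWeylGroup P) (hs : s ∈ MomentGraphs.simpleReflections b)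
    (M : MomentGraphs.Sheaf.{u, max f v, u, f, w} (MomentGraphs.affineMomentGraph b h2))
    (hM : M.IsProjective)
    (hGKM : ((MomentGraphs.affineMomentGraph b h2).full
      (M.supp ∪ (fun x : MomentGraphs.affineWeylGroup P => x * s) '' M.supp)).GKM) :
    ∃ h : M.OnWellDefined hs, (M.thetaOn hs h).IsProjective ∧ (M.theta hs h).IsProjective ∧
      (M.theta hs h).supp ⊆
        M.supp ∪ (fun x : MomentGraphs.affineWeylGroup P => x * s) '' M.supp := by
  have hG := hM.labelsIndependent hs hGKM
  have hw := hM.onWellDefined hs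
  have hon : (M.thetaOn hs hw).IsProjective := hM.thetaOn_isProjective hG
  refine ⟨hw, hon, hon.thetaOut_isProjective ?_, ?_⟩
  · rintro ⟨x, y, r, hne, hex⟩ ⟨E, h1, h3, h4⟩ hnt
    dsimp only at h1 h3 h4
    subst h1 h3 h4
    exact hG E hne hnt
  · intro x hx
    obtain ⟨y, hy, hyx⟩ :=
      MomentGraphs.Sheaf.exists_mem_supp_of_nontrivial (M := M) (hs := hs) hx
    rcases (MomentGraphs.mk_eq_iff b hs).mp hyx with h | h
    · exact Or.inl (by rw [h]; exact hy)
    · exact Or.inr ⟨y, hy, h.symm⟩
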